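/- **Setting.** Let $k\ge 2$ and let $a_1,\dots,a_k\ge 2^{22}$ be integers. Let $G=[a_1\times\cdots\times a_k]$ be the grid with vertices $x=(x_1,\dots,x_k)$, $1\le x_i\le a_i$. Put $e_0=0$, $e_i=\lceil\log_2(a_1\cdots a_i)\rceil$, $w_i=2^{e_i-e_{i-1}}$ and $P_i=a_{i+1}\cdots a_k$ (so $P_k=1$), and write $x_{1\to i}=(x_1,\dots,x_i)$. Grids are identified with their vertex sets; $\langle Y_i\rangle=[w_1\times\cdots\times w_i]$, and $Y_i=\langle Y_{i-1}\rangle\times\{1,2,3,\dots\}$. Let $Y_i^{c}$ (the $c$-th level) be the set of points of $Y_i$ with last coordinate $c$, $Y_i^{(r)}=\bigcup_{c\le r}Y_i^c$, let the $j$-th section be $S_i^j=\{x\in Y_i:(j-1)w_i<x_i\le jw_i\}$, and $S_i^{(r)}=\bigcup_{j\le r}S_i^j$. Let $u_i=\lceil |G|/2^{e_{i-1}}\rceil$. Let $D_i^1,\dots,D_i^{P_i}$ be the $i$-pages of $G$ (the sets obtained by fixing the last $k-i$ coordinates), ordered by comparing the fixed coordinates at the largest index where they differ, and $D_i^{(r)}=\bigcup_{j\le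 r}D_i^j$. $Q_n$ is the hypercube of $0/1$-strings of length $n$, and $Opt(G)=Q_n$ with $n=\lceil\log_2|G|\rceil$. For $i\le k$, a subset of $Y_i$ is said to be contained in $Opt(G)$ if it is contained in $\langle Y_{i-1}\rangle\times P(2^{\,n-e_{i-1}})$, where $P(l)$ is the path $1,\dots,l$; it is part of the assertion that this grid is a spanning subgraph of $Q_n$. Put $Opt'(G)=\langle Y_k\rangle$. **The map $f_2$.** Let $\rho=(2^{e_1}-a_1)/a_1$ and let $R$ be the $0/1$-matrix with rows $1,\dots,a_1$ and columns $1,2,\dots$ with $R_{i1}=\lfloor\rho i\rfloor-\lfloor\rho(i-1)\rfloor$ and $R_{i,j}=R_{i-1,j-1}$ for $j>1$ (row indices mod $a_1$). The points of $G$ with first coordinate $i$, ordered by the ordering of the $1$-pages, form the beginning of the $i$-th chain; each chain is an infinite sequence of points. Column $j$ of $Y_2$, for $j=1,2,\dots$, is filled from position $1$ upwards by the next $1+R_{ij}$ points of chain $i$, for $i=1,\dots,a_1$ in turn; two points of a chain in the same column are placed in increasing order of position if $j$ is odd and in decreasing order if $j$ is even. The resulting map is $f_2:G\to Y_2$, $f_2(x)=(\text{position},\text{column})$.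 **Blank levels.** For $2\le i\le k-1$ put $q_i=a_1\cdots a_i/2^{e_{i-1}}$, $\phi_i=\lceil q_i\rceil-q_i$ and $s_i(j)=w_i-\lceil q_i\rceil+\lfloor j\phi_i\rfloor-\lfloor(j-1)\phi_i\rfloor$. Let $T(i)$ be the $P_i\times w_i$ matrix all of whose entries in row $c$ are $s_i(c)/w_i$, and let $F(i)$ be any rounding of $T(i)$ (each entry replaced by its floor or ceiling) such that every initial row sum, every initial column sum and the total sum of $F(i)$ differs from that of $T(i)$ by less than $1$. The $d$-th level of $S_i^c$ ($1\le c\le P_i$) is blank if $F(i)_{cd}=1$ and nonblank if $F(i)_{cd}=0$. Let $N_{i,r}(b)$ be the column of the $b$-th zero in row $r$ of $F(i)$, and let $S_i^r(G)$, $S_i^{(r)}(G)$ be the sets of points of $S_i^r$, $S_i^{(r)}$ in nonblank levels ($r\le P_i$). **Inductive construction.** Let $2\le i\le k-1$. $I_i$ replaces the last coordinate $z_i$ of $z\in Y_i^{(u_i)}$ by the number of the $z_i$-th nonblank level of $S_i^{(P_i)}$. Put $S_i^r(G)'=S_i^r(G)\cap (I_i\circ f_i)(G)$ and $S_i^{(r)}(G)'=S_i^{(r)}(G)\cap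 (I_i\circ f_i)(G)$. For $y\in S_i^{r}(G)'$ let $\sigma_i(y)=(y_1,\dots,y_{i-1},\bar y_i,n_y)$, where $\bar y_i\equiv y_i \pmod{w_i}$, $1\le\bar y_i\le w_i$, and $n_y$ is the number of $z\in S_i^{(r)}(G)'$ with $z_{1\to i-1}=y_{1\to i-1}$ and $z_i\equiv y_i\pmod{w_i}$. Put $f_{i+1}=\sigma_i\circ I_i\circ f_i$. For $3\le i\le k$, $x\in\langle Y_{i-1}\rangle$ and $r\le P_{i-1}$ let $Stack_i(x,r)=\{\sigma_{i-1}(y): y\in S_{i-1}^{(r)}(G)',\ \sigma_{i-1}(y)_{1\to i-1}=x\}$ and $[r]_i=\max_x|Stack_i(x,r)|$. Finally, for each $t$ let $L_t:Q_t\to\{1,\dots,2^t\}$ be any bijection, and let $H^k(x)$ be the concatenation of the strings $L_{e_j-e_{j-1}}^{-1}(f_k(x)_j)$, $j=1,\dots,k$. **Lemma 5.1.** (a1) For $x\in G$, $1\le i<j\le k$: $f_j(x)_{1\to i}=f_{i+1}(x)_{1\to i}$. (a2) For $x\in G$, $2\le i\le k-1$ and $z=f_i(x)$: $I_i(z)=(z_1,\dots,z_{i-1},z_i')$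 with $z_i'=(r-1)w_i+N_{i,r}(b)$ for some $1\le r\le P_i$ and some $b\ge1$ not exceeding the number of zeros in row $r$ of $F(i)$, and $f_k(x)_i=N_{i,r}(b)$, $1\le f_k(x)_i\le w_i$. (b) For $x,y\in G$, $2\le i\le k$ and an integer $\varepsilon\ge0$: if $|f_i(x)_i-f_i(y)_i|\le \varepsilon$ then $|f_k(x)_i-f_k(y)_i|\le 2\varepsilon+2$, the last difference being taken modulo $w_i$ (i.e. $|f_k(x)_i-f_k(y)_i-mw_i|\le 2\varepsilon+2$ for some integer $m$). (c) For $2\le i\le k-1$, the map $y\mapsto\sigma_i(y)_{1\to i}$ is injective on $S_i^r(G)'$ for each $1\le r\le P_i$, and $\sigma_i$ is injective on $S_i^{(P_i)}(G)'$. For $2\le i\le k$, $f_i$ is injective on $G$. (d1) For $2\le i\le k-1$ and $1\le r<P_i$: $S_i^{(r)}(G)'=S_i^{(r)}(G)$. (d2) For $3\le i\le k$, $1\le t<P_{i-1}$, $x\in\langle Y_{i-1}\rangle$: $|Stack_i(x,t)|\in\{[t]_i,[t]_i-1\}$. (d3) For $3\le i\le k$, $1\le t<P_{i-1}$ and $x,y\in\langle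 Y_{i-1}\rangle$ with $x_{i-1}=y_{i-1}$: $|Stack_i(x,t)|=|Stack_i(y,t)|$. (e) Let $3\le i\le k$, $l(i,r)=\lceil |D_{i-1}^{(r)}|/2^{e_{i-1}}\rceil=\lceil ra_1\cdots a_{i-1}/2^{e_{i-1}}\rceil$ and $l'(i,r)=\lceil |D_{i}^{(r)}|/2^{e_{i-1}}\rceil=\lceil ra_1\cdots a_{i}/2^{e_{i-1}}\rceil$. (e1) For $1\le r\le P_{i-1}$: $[r]_i=l(i,r)$ and $|Y_i^{(l(i,r))}|-|f_i(D_{i-1}^{(r)})|<2^{e_{i-1}}$. (e2) $f_i(D_{i-1}^{(r)})\subseteq Y_i^{(l(i,r))}$ for $1\le r\le P_{i-1}$, and $f_i(D_{i}^{(r)})\subseteq Y_i^{(l'(i,r))}$ for $1\le r\le P_{i}$. (e3) For all $2\le i\le k$: $f_i(G)\subseteq Y_i^{(u_i)}\subseteq Opt(G)$. Moreover $f_k(G)\subseteq Opt'(G)$, $Opt'(G)$ is a spanning subgraph of $Opt(G)$, and $H^k(G)\subseteq Opt(G)$. (f) For $2\le i\le k-1$: $I_i(f_i(D_i^{(r)}))\subseteq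 S_i^{(r)}(G)$ for $1\le r\le P_i$, and $S_i^{(r)}(G)\subsetneq I_i(f_i(D_i^{(r+1)}))$ for $1\le r\le P_i-1$. (g) (Stack monotonicity) Let $3\le i\le k$, $1\le r\le P_{i-1}$, $x\in\langle Y_{i-1}\rangle$ and $w',w''\in Stack_i(x,r)$ with $\sigma_{i-1}^{-1}(w')\in S_{i-1}^c$, $\sigma_{i-1}^{-1}(w'')\in S_{i-1}^d$, $1\le c,d\le r$. Then $w''_i>w'_i\iff d>c$. -/

import Mathlib

namespace GridEmbedding

/-- The product `a 1 * a 2 * ⋯ * a i`. -/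
def vol (a : ℕ → ℕ) (i : ℕ) : ℕ := ∏ t ∈ Finset.Icc 1 i, a t

/-! ### Grids -/

/-- Points of grids of every dimension.  Coordinates are numbered from `1`; a point of a
`d`-dimensional grid has positive coordinates `x 1, …, x d` and is `0` at every other index. -/
abbrev Pt := ℕ → ℕ

/-- The vertex set of the `d`-dimensional grid `[s 1 × s 2 × ⋯ × s d]`. -/
def box (d : ℕ) (s : ℕ → ℕ) : Set Pt :=
  {x | (∀ q, 1 ≤ q → q ≤ d → 1 ≤ x q ∧ x q ≤ s q) ∧ ∀ q, q = 0 ∨ d < q → x q = 0}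

/-- Adjacency in a grid: the points differ in exactly one coordinate, and there by `1`. -/
def gridAdj (x y : Pt) : Prop :=
  ∃ q, (x q + 1 = y q ∨ y q + 1 = x q) ∧ ∀ r, r ≠ q → x r = y r

/-- `x_{1 → m}`: the point formed by the first `m` coordinates of `x`. -/
def proj (m : ℕ) (x : Pt) : Pt := fun q => if 1 ≤ q ∧ q ≤ m then x q else 0

/-- The vertex set of `G = [a 1 × ⋯ × a k]`. -/
def grid (a : ℕ → ℕ) (k : ℕ) : Set Pt := box k a

/-- `e_i = ⌈log₂ (a 1 ⋯ a i)⌉`; in particular `e_0 = 0`. -/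
def expo (a : ℕ → ℕ) (i : ℕ) : ℕ := Nat.clog 2 (vol a i)

/-- `2 ^ (e_i - e_{i-1})`. -/
def width (a : ℕ → ℕ) (i : ℕ) : ℕ := 2 ^ (expo a i - expo a (i - 1))

/-- `⟨Y_i⟩ = P(2^{e_1}) × P(2^{e_2 - e_1}) × ⋯ × P(2^{e_i - e_{i-1}})`. -/
def bracketY (a : ℕ → ℕ) (i : ℕ) : Set Pt := box i (width a)

/-- `Y_i = ⟨Y_{i-1}⟩ × P(l)` with `l` large enough; here the last coordinate ranges over all
positive integers. -/
def Y (a : ℕ → ℕ) (i : ℕ) : Set Pt :=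
  {x | (∀ q, 1 ≤ q → q < i → 1 ≤ x q ∧ x q ≤ width a q) ∧ 1 ≤ x i ∧
    ∀ q, q = 0 ∨ i < q → x q = 0}

/-- `Y_i^{(r)}`: the union of the first `r` many `(i-1)`-levels of `Y_i`. -/
def levelsUpTo (a : ℕ → ℕ) (i r : ℕ) : Set Pt := {x | x ∈ Y a i ∧ x i ≤ r}

/-- `S_i^j`: the `j`-th `i`-section of `Y_i`. -/
def sec (a : ℕ → ℕ) (i j : ℕ) : Set Pt :=
  {x | x ∈ Y a i ∧ (j - 1) * width a i + 1 ≤ x i ∧ x i ≤ j * width a i}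

/-- `u_i = ⌈|G| / 2^{e_{i-1}}⌉`. -/
noncomputable def numLevels (a : ℕ → ℕ) (k i : ℕ) : ℕ :=
  ⌈((grid a k).ncard : ℚ) / 2 ^ expo a (i - 1)⌉₊

/-! ### Pages of `G` -/

/-- `P_i = a (i+1) ⋯ a k`, the number of `i`-pages of `G`. -/
def numPages (a : ℕ → ℕ) (k i : ℕ) : ℕ := ∏ t ∈ Finset.Icc (i + 1) k, a t

/-- The `i`-page through `x` comes strictly before the `i`-page through `y`: at the maximum index
`t ∈ {i+1, …, k}` where `x` and `y` differ, `x t < y t`. -/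
def pageLT (k i : ℕ) (x y : Pt) : Prop :=
  ∃ t, i + 1 ≤ t ∧ t ≤ k ∧ x t < y t ∧ ∀ q, t < q → q ≤ k → x q = y q

/-- The position, counted from `1`, of the `i`-page through `x` in the ordering `pageLT` of all
`i`-pages (see `pageIndex_lt_iff` and `pageIndex_mem`). -/
def pageIndex (a : ℕ → ℕ) (k i : ℕ) (x : Pt) : ℕ :=
  1 + ∑ t ∈ Finset.Icc (i + 1) k, (x t - 1) * ∏ s ∈ Finset.Icc (i + 1) (t - 1), a s

theorem pageIndex_succ (a : ℕ → ℕ) (i n : ℕ) (x : Pt) :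
    pageIndex a (i + (n + 1)) i x
      = pageIndex a (i + n) i x + (x (i + n + 1) - 1) * numPages a (i + n) i := by
  unfold pageIndex numPages
  rw [← add_assoc, Finset.sum_Icc_succ_top (by omega)]
  simp [add_assoc]

/-- Pages are numbered within `1, …, P_i`. -/
theorem pageIndex_mem (a : ℕ → ℕ) (i n : ℕ) (x : Pt)
    (hx : ∀ t, i + 1 ≤ t → t ≤ i + n → 1 ≤ x t ∧ x t ≤ a t) :
    1 ≤ pageIndex a (i + n) i x ∧ pageIndex a (i + n) i x ≤ numPages a (i + n) i := by
  refine ⟨by unfold pageIndex; omega, ?_⟩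
  induction n with
  | zero => simp [pageIndex, numPages]
  | succ n ih =>
    have h1 := ih fun t ht ht' => hx t ht (by omega)
    have h2 := hx (i + n + 1) (by omega) (by omega)
    have e2 : numPages a (i + (n + 1)) i = numPages a (i + n) i * a (i + n + 1) := by
      unfold numPages
      rw [← add_assoc, Finset.prod_Icc_succ_top (by omega)]
    rw [pageIndex_succ, e2]
    obtain ⟨b, hb⟩ : ∃ b, x (i + n + 1) = b + 1 := ⟨x (i + n + 1) - 1, by omega⟩
    rw [hb, Nat.add_sub_cancel]
    calc _ ≤ numPages a (i + n) i + b * numPages a (i + n) i := by omega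
      _ = numPages a (i + n) i * (b + 1) := by ring
      _ ≤ _ := Nat.mul_le_mul_left _ (by omega)

/-- The numbering of pages is the one given by the ordering `pageLT`. -/
theorem pageIndex_lt_iff (a : ℕ → ℕ) (i n : ℕ) (x y : Pt)
    (hx : ∀ t, i + 1 ≤ t → t ≤ i + n → 1 ≤ x t ∧ x t ≤ a t)
    (hy : ∀ t, i + 1 ≤ t → t ≤ i + n → 1 ≤ y t ∧ y t ≤ a t) :
    pageIndex a (i + n) i x < pageIndex a (i + n) i y ↔ pageLT (i + n) i x y := by
  induction n with
  | zero =>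
    simp only [pageIndex, pageLT, add_zero]
    constructor
    · intro h; simp at h
    · rintro ⟨t, h1, h2, _⟩; omega
  | succ n ih =>
    have ih' := ih (fun t ht ht' => hx t ht (by omega)) (fun t ht ht' => hy t ht (by omega))
    have bx := pageIndex_mem a i n x fun t ht ht' => hx t ht (by omega)
    have bY := pageIndex_mem a i n y fun t ht ht' => hy t ht (by omega)
    have hx1 := (hx (i + n + 1) (by omega) (by omega)).1
    have hy1 := (hy (i + n + 1) (by omega) (by omega)).1
    obtain ⟨b, hb⟩ : ∃ b, x (i + n + 1) = b + 1 := ⟨x (i + n + 1) - 1, by omega⟩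
    obtain ⟨c, hc⟩ : ∃ c, y (i + n + 1) = c + 1 := ⟨y (i + n + 1) - 1, by omega⟩
    rw [pageIndex_succ, pageIndex_succ, hb, hc, Nat.add_sub_cancel, Nat.add_sub_cancel]
    rcases lt_trichotomy b c with h | h | h
    · have hm : (b + 1) * numPages a (i + n) i ≤ c * numPages a (i + n) i :=
        Nat.mul_le_mul_right _ h
      rw [add_mul, one_mul] at hm
      refine iff_of_true (by omega) ⟨i + n + 1, by omega, by omega, by omega, ?_⟩
      intro q h1 h2; omega
    · subst h
      rw [Nat.add_lt_add_iff_right, ih']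
      constructor
      · rintro ⟨t, h1, h2, h3, h4⟩
        refine ⟨t, h1, by omega, h3, fun q hq hq' => ?_⟩
        by_cases hq2 : q ≤ i + n
        · exact h4 q hq hq2
        · obtain rfl : q = i + n + 1 := by omega
          rw [hb, hc]
      · rintro ⟨t, h1, h2, h3, h4⟩
        have : t ≠ i + n + 1 := by rintro rfl; omega
        exact ⟨t, h1, by omega, h3, fun q hq hq' => h4 q hq (by omega)⟩
    · have hm : (c + 1) * numPages a (i + n) i ≤ b * numPages a (i + n) i :=
        Nat.mul_le_mul_right _ h
      rw [add_mul, one_mul] at hm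
      refine iff_of_false (by omega) ?_
      rintro ⟨t, h1, h2, h3, h4⟩
      by_cases ht : t = i + n + 1
      · subst ht; omega
      · have := h4 (i + n + 1) (by omega) (by omega)
        omega

/-- `D_i^j`, the `j`-th `i`-page. -/
def page (a : ℕ → ℕ) (k i j : ℕ) : Set Pt := {x | x ∈ grid a k ∧ pageIndex a k i x = j}

/-- `D_i^{(r)} = D_i^1 ∪ ⋯ ∪ D_i^r`. -/
def pagesUpTo (a : ℕ → ℕ) (k i r : ℕ) : Set Pt := ⋃ j ∈ Set.Icc 1 r, page a k i j

/-! ### The two-dimensional map -/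

/-- The circulant `(0,1)`-matrix `R` with `a 1` rows and columns `1, 2, …`.  The first column is
`R_{i1} = ⌊ρ i⌋ - ⌊ρ (i-1)⌋` with `ρ = (2^{e_1} - a 1) / a 1`, and each further column is the
downward cyclic shift of the preceding one.  The first argument after `a` is the column. -/
def shiftMatrix (a : ℕ → ℕ) : ℕ → ℕ → ℕ
  | 0, _ => 0
  | 1, i => ⌊((2 : ℚ) ^ expo a 1 - a 1) / a 1 * (i : ℚ)⌋₊ -
      ⌊((2 : ℚ) ^ expo a 1 - a 1) / a 1 * ((i : ℚ) - 1)⌋₊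
  | j + 2, i => shiftMatrix a (j + 1) (if i = 1 then a 1 else i - 1)

/-- `N_{ij} = j + ∑_{t=1}^j R_{it}`: the number of points of the `i`-th chain which are mapped to
the first `j` columns. -/
def chainCount (a : ℕ → ℕ) (i j : ℕ) : ℕ := j + ∑ t ∈ Finset.Icc 1 j, shiftMatrix a t i

/-- The column that receives the `y`-th point of the `i`-th chain: chain `i` contributes its next
`1 + R_{ij}` points to column `j`, for `j = 1, 2, …`. -/
noncomputable def chainCol (a : ℕ → ℕ) (i y : ℕ) : ℕ := sInf {j | y ≤ chainCount a i j}

/-- The row that receives the `y`-th point of the `i`-th chain.  In its column `j` the chains are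
laid down in increasing order, chain `t` occupying `1 + R_{tj}` successive positions; if chain `i`
occupies two positions, they are filled upwards when `j` is odd and downwards when `j` is even. -/
noncomputable def chainRow (a : ℕ → ℕ) (i y : ℕ) : ℕ :=
  let j := chainCol a i y
  let c := ∑ t ∈ Finset.Icc 1 (i - 1), (1 + shiftMatrix a j t)
  let d := y - chainCount a i (j - 1)
  if shiftMatrix a j i = 0 then c + 1 else if Even j then c + 3 - d else c + d

/-- The map `f_2`.  The point `x` of `G` is point number `pageIndex a k 1 x` of chain `x 1`. -/
noncomputable def f₂ (a : ℕ → ℕ) (k : ℕ) (x : Pt) : Pt := fun q =>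
  if q = 1 then chainRow a (x 1) (pageIndex a k 1 x)
  else if q = 2 then chainCol a (x 1) (pageIndex a k 1 x)
  else 0

/-! ### Blank levels -/

/-- `φ_i`. -/
def blankSlope (a : ℕ → ℕ) (i : ℕ) : ℚ :=
  (⌈(vol a i : ℚ) / 2 ^ expo a (i - 1)⌉ : ℚ) - (vol a i : ℚ) / 2 ^ expo a (i - 1)

/-- `s_i(j)`, the prescribed number of blank levels in the `j`-th `i`-section. -/
def blankCount (a : ℕ → ℕ) (i j : ℕ) : ℤ :=
  (width a i : ℤ) - ⌈(vol a i : ℚ) / 2 ^ expo a (i - 1)⌉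
    + ⌊(j : ℚ) * blankSlope a i⌋ - ⌊((j : ℚ) - 1) * blankSlope a i⌋

/-- `F` is a rounding of the `m × n` matrix `T` (indices from `1`) whose initial row sums, initial
column sums and total sum differ by less than `1` from those of `T`. -/
def IsRounding (m n : ℕ) (T : ℕ → ℕ → ℚ) (F : ℕ → ℕ → ℤ) : Prop :=
  (∀ c ∈ Finset.Icc 1 m, ∀ d ∈ Finset.Icc 1 n, F c d = ⌊T c d⌋ ∨ F c d = ⌈T c d⌉) ∧
  (∀ c ∈ Finset.Icc 1 m, ∀ b ∈ Finset.Icc 1 n,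
    |∑ d ∈ Finset.Icc 1 b, (T c d - (F c d : ℚ))| < 1) ∧
  (∀ d ∈ Finset.Icc 1 n, ∀ b ∈ Finset.Icc 1 m,
    |∑ c ∈ Finset.Icc 1 b, (T c d - (F c d : ℚ))| < 1) ∧
  |∑ c ∈ Finset.Icc 1 m, ∑ d ∈ Finset.Icc 1 n, (T c d - (F c d : ℚ))| < 1

/-- `F` can serve as the blank-level matrix `F(i)`: it is a rounding of the
`P_i × 2^{e_i - e_{i-1}}` matrix whose row `c` is constant, equal to
`s_i(c) / 2^{e_i - e_{i-1}}`. -/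
def IsBlankMatrix (a : ℕ → ℕ) (k i : ℕ) (F : ℕ → ℕ → ℤ) : Prop :=
  IsRounding (numPages a k i) (width a i)
    (fun c _ => (blankCount a i c : ℚ) / (width a i : ℚ)) F

/-- The `(i-1)`-level number `m` of `Y_i` lies in `S_i^{(P_i)}` and is nonblank.  It is level
`(m - 1) % width + 1` of section `(m - 1) / width + 1`. -/
def Nonblank (a : ℕ → ℕ) (k : ℕ) (F : ℕ → ℕ → ℕ → ℤ) (i m : ℕ) : Prop :=
  1 ≤ m ∧ m ≤ numPages a k i * width a i ∧
    F i ((m - 1) / width a i + 1) ((m - 1) % width a i + 1) = 0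

/-- `N_r(d)`: the column of the `d`-th zero in row `r` of `F(i)`. -/
noncomputable def zeroCol (F : ℕ → ℕ → ℕ → ℤ) (i r d : ℕ) : ℕ :=
  sInf {b : ℕ | (b : ℤ) = d + ∑ j ∈ Finset.Icc 1 b, F i r j}

/-- `S_i^r(G)`: the points of the `r`-th `i`-section in nonblank levels. -/
def secG (a : ℕ → ℕ) (k : ℕ) (F : ℕ → ℕ → ℕ → ℤ) (i r : ℕ) : Set Pt :=
  {x | x ∈ sec a i r ∧ Nonblank a k F i (x i)}

/-- `S_i^{(r)}(G) = S_i^1(G) ∪ ⋯ ∪ S_i^r(G)`. -/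
def secsG (a : ℕ → ℕ) (k : ℕ) (F : ℕ → ℕ → ℕ → ℤ) (i r : ℕ) : Set Pt :=
  ⋃ j ∈ Set.Icc 1 r, secG a k F i j

/-! ### Inflation, stacking, and the maps `f_i` -/

/-- The inflation map `I_i`: the last coordinate `z i` is replaced by the number of the `z i`-th
nonblank level. -/
noncomputable def inflate (a : ℕ → ℕ) (k : ℕ) (F : ℕ → ℕ → ℕ → ℤ) (i : ℕ) (z : Pt) : Pt :=
  Function.update z i (Nat.nth (Nonblank a k F i) (z i - 1))

/-- The stacking map of a set `A` of points of `Y_i`: the `i`-th coordinate of `y` is reduced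
modulo `2^{e_i - e_{i-1}}` to the range `1, …, 2^{e_i - e_{i-1}}`, and the new coordinate `i + 1`
counts the points of `A` with the same reduction as `y` in the sections up to that of `y`. -/
noncomputable def stackMap (a : ℕ → ℕ) (k : ℕ) (F : ℕ → ℕ → ℕ → ℤ) (i : ℕ) (A : Set Pt)
    (y : Pt) : Pt :=
  Function.update (Function.update y i ((y i - 1) % width a i + 1)) (i + 1)
    {z | z ∈ secsG a k F i ((y i - 1) / width a i + 1) ∩ A ∧
      proj (i - 1) z = proj (i - 1) y ∧ z i ≡ y i [MOD width a i]}.ncard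

/-- The maps `f_i`, for `i ≥ 2`: `f_2` is the two-dimensional map and
`f_{i+1} = σ_i ∘ I_i ∘ f_i`.  (The values for `i = 0, 1` are irrelevant.) -/
noncomputable def fMap (a : ℕ → ℕ) (k : ℕ) (F : ℕ → ℕ → ℕ → ℤ) : ℕ → Pt → Pt
  | 0 => id
  | 1 => id
  | 2 => f₂ a k
  | i + 3 =>
      stackMap a k F (i + 2) ((inflate a k F (i + 2) ∘ fMap a k F (i + 2)) '' grid a k) ∘
        inflate a k F (i + 2) ∘ fMap a k F (i + 2)

/-- The stacking map `σ_i`. -/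
noncomputable def sigma (a : ℕ → ℕ) (k : ℕ) (F : ℕ → ℕ → ℕ → ℤ) (i : ℕ) : Pt → Pt :=
  stackMap a k F i ((inflate a k F i ∘ fMap a k F i) '' grid a k)

/-- `S_i^r(G)' = S_i^r(G) ∩ (I_i ∘ f_i)(G)`. -/
def secG' (a : ℕ → ℕ) (k : ℕ) (F : ℕ → ℕ → ℕ → ℤ) (i r : ℕ) : Set Pt :=
  secG a k F i r ∩ (inflate a k F i ∘ fMap a k F i) '' grid a k

/-- `S_i^{(r)}(G)' = S_i^{(r)}(G) ∩ (I_i ∘ f_i)(G)`. -/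
def secsG' (a : ℕ → ℕ) (k : ℕ) (F : ℕ → ℕ → ℕ → ℤ) (i r : ℕ) : Set Pt :=
  secsG a k F i r ∩ (inflate a k F i ∘ fMap a k F i) '' grid a k

/-- `Stack_i(x, r)`. -/
def Stack (a : ℕ → ℕ) (k : ℕ) (F : ℕ → ℕ → ℕ → ℤ) (i : ℕ) (x : Pt) (r : ℕ) : Set Pt :=
  {w | ∃ y ∈ secsG' a k F (i - 1) r, w = sigma a k F (i - 1) y ∧ proj (i - 1) w = x}

/-- `[r]_i`, the maximum of `|Stack_i(x, r)|` over `x ∈ ⟨Y_{i-1}⟩` (a finite nonempty set). -/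
noncomputable def maxHeight (a : ℕ → ℕ) (k : ℕ) (F : ℕ → ℕ → ℕ → ℤ) (i r : ℕ) : ℕ :=
  sSup ((fun x => (Stack a k F i x r).ncard) '' bracketY a (i - 1))

/-! ### Hypercubes -/

/-- The vertex set of the hypercube `Q_n`: the strings of length `n` over `{0, 1}`. -/
def cube (n : ℕ) : Set (List Bool) := {w | w.length = n}

/-- Adjacency in a hypercube: the strings disagree in exactly one position. -/
def cubeAdj (v w : List Bool) : Prop := ∃ s b t, v = s ++ b :: t ∧ w = s ++ (!b) :: t

/-- `⌈log₂ |G|⌉`, the dimension of the hypercube `Opt(G)`. -/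
noncomputable def optDim (a : ℕ → ℕ) (k : ℕ) : ℕ := Nat.clog 2 (grid a k).ncard

/-- The grid with vertex set `B` is (isomorphic to) a spanning subgraph of the hypercube `Q_n`. -/
def IsSpanningSubgraphOfCube (B : Set Pt) (n : ℕ) : Prop :=
  ∃ φ : Pt → List Bool, Set.BijOn φ B (cube n) ∧
    ∀ x ∈ B, ∀ y ∈ B, gridAdj x y → cubeAdj (φ x) (φ y)

/-- The grid `⟨Y_{i-1}⟩ × P(2^{⌈log₂ |G|⌉ - e_{i-1}})`, through which subgrids of `Y_i` are regarded
as parts of `Opt(G)`. -/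
def optGrid (a : ℕ → ℕ) (k i : ℕ) : Set Pt :=
  levelsUpTo a i (2 ^ (optDim a k - expo a (i - 1)))

/-- The map `H^k`: every coordinate `f_k(x)_j` is replaced by the string
`L_{e_j - e_{j-1}}⁻¹ (f_k(x)_j)` of length `e_j - e_{j-1}`, and these strings are concatenated. -/
noncomputable def cubeMap (a : ℕ → ℕ) (k : ℕ) (F : ℕ → ℕ → ℕ → ℤ) (L : ℕ → List Bool → ℕ)
    (x : Pt) : List Bool :=
  (List.range' 1 k).flatMap fun j =>
    Function.invFunOn (L (expo a j - expo a (j - 1))) (cube (expo a j - expo a (j - 1)))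
      (fMap a k F k x j)

end GridEmbedding

open GridEmbedding

namespace GridEmbedding

/-! ### Arithmetic -/

/-! The proof is one induction on `i`, and its invariant is `FillsPages`. The map $f_i$ is
injective. It puts the first $r$ of the $i$-pages into the least number $\lceil r\,a_1\cdots
a_i/2^{e_{i-1}}\rceil$ of levels that could hold them. For $r<P_i$, the first $r+1$ pages already
cover one level more than that number. The covering clause is what allows stack heights to be read
off from the blank-level matrix alone.

Base case. With $\alpha=2^{e_1}/a_1\in[1,2)$, the entries of $R$ are $\lfloor
m\alpha\rfloor-\lfloor(m-1)\alpha\rfloor-1$ with $m=i-j+1$ in column $j$. Sums along a row and down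
a column therefore telescope. Each column receives exactly $2^{e_1}$ points, and the first $j$
columns take $j\alpha$ points of each chain up to an error less than $1$ (`columnCount_top`,
`mul_chainCount_lt`, `lt_mul_chainCount_add`).

Inflation. The row sums of $F(i)$ are exactly $s_i(c)$, and $\sum_{c\le r}(w_i-s_i(c))$ telescopes
to $\lceil r\,a_1\cdots a_i/2^{e_{i-1}}\rceil$. So the nonblank levels of the first $r$ sections are
equinumerous with the levels allotted to $r$ pages, and pages stay synchronised with sections
(`count_nonblank_sections`, `inflate_le_iff`).

Stacking. By the covering clause every nonblank point of every section but the last is hit. The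
stack over $x$ formed by $r<P_i$ sections thus has as many points as column $x_i$ of $F(i)$ has
zeros in its first $r$ rows. The bound on initial column sums leaves two consecutive values for this
number, the larger being $\lceil r\,a_1\cdots a_i/2^{e_i}\rceil$ (`column_sum_bounds`). Since $r$ of
the $(i+1)$-pages are $ra_{i+1}$ of the $i$-pages, this is the invariant for $i+1$; the side lengths
are large enough to absorb the rounding errors (`fillsPages_succ`).

Coordinate growth is separate: at most half of each section is blank and the initial row sums are
balanced, so two nonblank levels are at most about twice as far apart as their ranks
(`level_sub_le`). The hypercube statements follow from Gray codes. -/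

theorem ceil_div_two_pow_le {n e m : ℕ} : ⌈(n : ℚ) / 2 ^ e⌉₊ ≤ m ↔ n ≤ m * 2 ^ e := by
  rw [Nat.ceil_le, div_le_iff₀ (by positivity)]
  exact_mod_cast Iff.rfl

theorem ceil_div_two_pow_mono {m n e : ℕ} (h : m ≤ n) :
    ⌈(m : ℚ) / 2 ^ e⌉₊ ≤ ⌈(n : ℚ) / 2 ^ e⌉₊ :=
  ceil_div_two_pow_le.2 (h.trans (ceil_div_two_pow_le.1 le_rfl))

theorem ceil_mul_two_pow_lt (n e : ℕ) : ⌈(n : ℚ) / 2 ^ e⌉₊ * 2 ^ e < n + 2 ^ e := by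
  by_contra h
  -- Otherwise one unit less would suffice; with truncated subtraction this is possible only if the
  -- ceiling is `0`.
  have : ⌈(n : ℚ) / 2 ^ e⌉₊ ≤ ⌈(n : ℚ) / 2 ^ e⌉₊ - 1 := by
    rw [ceil_div_two_pow_le, Nat.sub_mul]
    omega
  have h0 : ⌈(n : ℚ) / 2 ^ e⌉₊ = 0 := by omega
  have : 0 < 2 ^ e := by positivity
  rw [h0] at h
  omega

/-- A discrete intermediate value argument: the count starts at `0` and grows by one exactly at the
points of `p`. It supplies both the nonblank level of given rank and the section at given height in
a stack. -/
theorem exists_count_eq_of_lt_count (p : ℕ → Prop) [DecidablePred p] {n N : ℕ}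
    (h : n < Nat.count p N) : ∃ m, m < N ∧ p m ∧ Nat.count p m = n := by
  induction N with
  | zero => simp at h
  | succ N ih =>
    by_cases h1 : n < Nat.count p N
    · obtain ⟨m, h2, h3⟩ := ih h1
      exact ⟨m, by omega, h3⟩
    · rw [Nat.count_succ] at h
      split_ifs at h with h2
      · exact ⟨N, by omega, h2, by omega⟩
      · omega

theorem vol_zero (a : ℕ → ℕ) : vol a 0 = 1 := by simp [vol]

theorem vol_succ (a : ℕ → ℕ) (i : ℕ) : vol a (i + 1) = vol a i * a (i + 1) :=
  Finset.prod_Icc_succ_top (by omega) _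

theorem vol_pos {a : ℕ → ℕ} {i : ℕ} (ha : ∀ t, 1 ≤ t → t ≤ i → 1 ≤ a t) : 1 ≤ vol a i := by
  show 0 < ∏ t ∈ Finset.Icc 1 i, a t
  exact Finset.prod_pos fun t ht => ha t (Finset.mem_Icc.1 ht).1 (Finset.mem_Icc.1 ht).2

theorem numPages_self (a : ℕ → ℕ) (k : ℕ) : numPages a k k = 1 := by simp [numPages]

theorem numPages_eq_mul {a : ℕ → ℕ} {k i : ℕ} (h : i + 1 ≤ k) :
    numPages a k i = a (i + 1) * numPages a k (i + 1) := by
  unfold numPages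
  rw [← Finset.insert_Icc_add_one_left_eq_Icc h, Finset.prod_insert (by simp)]

theorem numPages_mul_vol {a : ℕ → ℕ} {k i : ℕ} (h : i ≤ k) :
    numPages a k i * vol a i = vol a k := by
  induction h using Nat.decreasingInduction with
  | self => simp [numPages_self]
  | of_succ i hi ih => rw [← ih, numPages_eq_mul hi, vol_succ]; ring

theorem expo_zero (a : ℕ → ℕ) : expo a 0 = 0 := by simp [expo, vol_zero]

theorem vol_le_two_pow_expo (a : ℕ → ℕ) (i : ℕ) : vol a i ≤ 2 ^ expo a i :=
  Nat.le_pow_clog (by norm_num) _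

/-- Minimality of the exponent. This factor `2` is behind $\alpha<2$ for the chains and behind the
bound of one half on the share of blank levels. -/
theorem two_pow_expo_lt {a : ℕ → ℕ} {i : ℕ} (h : 1 ≤ vol a i) : 2 ^ expo a i < 2 * vol a i := by
  rcases Nat.lt_or_ge 1 (vol a i) with h1 | h1
  · have h2 : 2 ^ (expo a i - 1) < vol a i := Nat.pow_pred_clog_lt_self (by norm_num) h1
    have h3 : 0 < expo a i := Nat.clog_pos (by norm_num) h1
    obtain ⟨e, he⟩ : ∃ e, expo a i = e + 1 := ⟨expo a i - 1, by omega⟩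
    rw [he, Nat.add_sub_cancel] at h2
    rw [he, pow_succ]
    omega
  · have : vol a i = 1 := by omega
    simp [expo, this]

theorem expo_le_expo {a : ℕ → ℕ} {i j k : ℕ} (ha : ∀ t, 1 ≤ t → t ≤ k → 1 ≤ a t) (hij : i ≤ j)
    (hj : j ≤ k) : expo a i ≤ expo a j := by
  induction hij with
  | refl => rfl
  | step h ih =>
    refine (ih (by omega)).trans (Nat.clog_mono_right _ ?_)
    rw [vol_succ]
    exact Nat.le_mul_of_pos_right _ (ha _ (by omega) hj)

theorem two_pow_expo_mul_width {a : ℕ → ℕ} {i : ℕ} (h : expo a (i - 1) ≤ expo a i) :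
    2 ^ expo a (i - 1) * width a i = 2 ^ expo a i := by
  rw [width, ← pow_add]
  congr 1
  omega

theorem width_pos (a : ℕ → ℕ) (i : ℕ) : 0 < width a i := by unfold width; positivity

theorem prod_width {a : ℕ → ℕ} {i k : ℕ} (ha : ∀ t, 1 ≤ t → t ≤ k → 1 ≤ a t) (hi : i ≤ k) :
    ∏ t ∈ Finset.Icc 1 i, width a t = 2 ^ expo a i := by
  induction i with
  | zero => simp [expo_zero]
  | succ i ih =>
    rw [Finset.prod_Icc_succ_top (by omega), ih (by omega)]
    have h := two_pow_expo_mul_width (expo_le_expo ha (Nat.sub_le (i + 1) 1) hi)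
    rwa [Nat.add_sub_cancel] at h

/-! ### Boxes -/

theorem box_zero (s : ℕ → ℕ) : box 0 s = {0} := by
  ext x
  simp only [box, Set.mem_ofPred_eq, Set.mem_singleton_iff]
  constructor
  · rintro ⟨-, h⟩
    funext q
    exact h q (by omega)
  · rintro rfl
    exact ⟨fun q _ _ => by omega, fun _ _ => rfl⟩

/-- Splitting off the last coordinate, which drives the inductions for cardinalities and for Gray
codes. Vanishing outside `1, …, d` makes the splitting unique. -/
theorem box_succ (d : ℕ) (s : ℕ → ℕ) :
    box (d + 1) s =
      (fun p : Pt × ℕ => Function.update p.1 (d + 1) p.2) '' (box d s ×ˢ Set.Icc 1 (s (d + 1))) := by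
  ext x
  constructor
  · rintro ⟨h1, h2⟩
    refine ⟨(Function.update x (d + 1) 0, x (d + 1)), ⟨⟨?_, ?_⟩, ?_⟩, ?_⟩
    · intro q hq hq'
      simp only
      rw [Function.update_of_ne (by omega)]
      exact h1 q hq (by omega)
    · intro q hq
      by_cases h : q = d + 1
      · simp [h]
      · simp only
        rw [Function.update_of_ne h]
        exact h2 q (by omega)
    · exact h1 (d + 1) (by omega) le_rfl
    · simp
  · rintro ⟨⟨y, c⟩, ⟨⟨h1, h2⟩, h3⟩, rfl⟩
    refine ⟨fun q hq hq' => ?_, fun q hq => ?_⟩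
    · by_cases h : q = d + 1
      · subst h; simpa using h3
      · simpa [h] using h1 q hq (by omega)
    · simpa [show q ≠ d + 1 by omega] using h2 q (by omega)

theorem update_succ_injOn_box (d : ℕ) (s : ℕ → ℕ) (C : Set ℕ) :
    Set.InjOn (fun p : Pt × ℕ => Function.update p.1 (d + 1) p.2) (box d s ×ˢ C) := by
  rintro ⟨y, c⟩ ⟨hy, -⟩ ⟨z, e⟩ ⟨hz, -⟩ h
  have h' := fun q => congrFun h q
  simp only at h'
  refine Prod.ext (funext fun q => ?_) ?_
  · by_cases hq : q = d + 1
    · exact (hy.2 q (by omega)).trans (hz.2 q (by omega)).symm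
    · simpa [hq] using h' q
  · simpa using h' (d + 1)

theorem box_finite (d : ℕ) (s : ℕ → ℕ) : (box d s).Finite := by
  induction d with
  | zero => simp [box_zero]
  | succ d ih => rw [box_succ]; exact (ih.prod (Set.finite_Icc _ _)).image _

theorem ncard_box (d : ℕ) (s : ℕ → ℕ) : (box d s).ncard = ∏ t ∈ Finset.Icc 1 d, s t := by
  induction d with
  | zero => simp [box_zero]
  | succ d ih =>
    rw [box_succ, (update_succ_injOn_box d s _).ncard_image, Set.ncard_prod, ih,
      Finset.prod_Icc_succ_top (by omega)]
    simp [← Finset.coe_Icc]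

theorem levelsUpTo_eq_box {a : ℕ → ℕ} {i r : ℕ} (hi : 1 ≤ i) :
    levelsUpTo a i r = box i (Function.update (width a) i r) := by
  ext x
  constructor
  · rintro ⟨⟨h1, h2, h3⟩, h4⟩
    refine ⟨fun q hq hq' => ?_, h3⟩
    by_cases h : q = i
    · subst h; simpa using ⟨h2, h4⟩
    · simpa [h] using h1 q hq (by omega)
  · rintro ⟨h1, h2⟩
    have h3 := h1 i hi le_rfl
    simp only [Function.update_self] at h3
    refine ⟨⟨fun q hq hq' => ?_, h3.1, h2⟩, h3.2⟩
    simpa [hq'.ne] using h1 q hq hq'.le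

theorem ncard_levelsUpTo {a : ℕ → ℕ} {i k r : ℕ} (ha : ∀ t, 1 ≤ t → t ≤ k → 1 ≤ a t) (hi : 1 ≤ i)
    (hik : i ≤ k) : (levelsUpTo a i r).ncard = r * 2 ^ expo a (i - 1) := by
  obtain ⟨j, rfl⟩ : ∃ j, i = j + 1 := ⟨i - 1, by omega⟩
  rw [levelsUpTo_eq_box hi, ncard_box, Finset.prod_Icc_succ_top (by omega), Function.update_self,
    Nat.add_sub_cancel, ← prod_width ha (show j ≤ k by omega), mul_comm]
  congr 1
  refine Finset.prod_congr rfl fun t ht => Function.update_of_ne ?_ _ _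
  have := Finset.mem_Icc.1 ht
  omega

theorem ncard_grid (a : ℕ → ℕ) (k : ℕ) : (grid a k).ncard = vol a k := ncard_box k a

/-! ### The ordering of the pages -/

theorem pageIndex_pos (a : ℕ → ℕ) (k i : ℕ) (x : Pt) : 1 ≤ pageIndex a k i x := by
  unfold pageIndex; omega

theorem pageIndex_le_numPages {a : ℕ → ℕ} {k i : ℕ} {x : Pt} (hx : x ∈ grid a k) (hi : i ≤ k) :
    pageIndex a k i x ≤ numPages a k i := by
  obtain ⟨n, rfl⟩ := Nat.exists_eq_add_of_le hi
  exact (pageIndex_mem a i n x fun t h1 h2 => hx.1 t (by omega) h2).2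

/-- Up to the shift by one, the page index is a mixed-radix numeral; passing from `i + 1` to `i`
appends `x (i + 1) - 1` as the least significant digit. -/
theorem pageIndex_eq_add_mul {a : ℕ → ℕ} {k i : ℕ} {x : Pt} (hx : x ∈ grid a k) (hi : i + 1 ≤ k) :
    pageIndex a k i x = x (i + 1) + a (i + 1) * (pageIndex a k (i + 1) x - 1) := by
  have h1 := (hx.1 (i + 1) (by omega) hi).1
  unfold pageIndex
  rw [← Finset.insert_Icc_add_one_left_eq_Icc hi, Finset.sum_insert (by simp), Nat.add_sub_cancel_left,
    Finset.mul_sum]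
  have h2 : ∀ t ∈ Finset.Icc (i + 1 + 1) k,
      (x t - 1) * ∏ s ∈ Finset.Icc (i + 1) (t - 1), a s =
        a (i + 1) * ((x t - 1) * ∏ s ∈ Finset.Icc (i + 1 + 1) (t - 1), a s) := by
    intro t ht
    have := Finset.mem_Icc.1 ht
    rw [← Finset.insert_Icc_add_one_left_eq_Icc (show i + 1 ≤ t - 1 by omega),
      Finset.prod_insert (by simp)]
    ring
  rw [Finset.sum_congr rfl h2]
  simp
  omega

/-- An `(i + 1)`-page is a block of `a (i + 1)` consecutive `i`-pages. -/
theorem pageIndex_le_mul_iff {a : ℕ → ℕ} {k i : ℕ} {x : Pt} (hx : x ∈ grid a k) (hi : i + 1 ≤ k)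
    (r : ℕ) : pageIndex a k i x ≤ r * a (i + 1) ↔ pageIndex a k (i + 1) x ≤ r := by
  have h1 := hx.1 (i + 1) (by omega) hi
  have h2 := pageIndex_pos a k (i + 1) x
  rw [pageIndex_eq_add_mul hx hi]
  obtain ⟨p, hp⟩ : ∃ p, pageIndex a k (i + 1) x = p + 1 :=
    ⟨pageIndex a k (i + 1) x - 1, by omega⟩
  rw [hp, Nat.add_sub_cancel]
  constructor
  · intro h
    by_contra h3
    have : r * a (i + 1) ≤ a (i + 1) * p := by
      rw [mul_comm]; exact Nat.mul_le_mul_left _ (by omega)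
    omega
  · intro h
    have : (p + 1) * a (i + 1) ≤ r * a (i + 1) := Nat.mul_le_mul_right _ h
    have : (p + 1) * a (i + 1) = a (i + 1) * p + a (i + 1) := by ring
    omega

theorem pageIndex_zero_le_iff {a : ℕ → ℕ} {k i : ℕ} {x : Pt} (hx : x ∈ grid a k) (hi : i ≤ k)
    (r : ℕ) : pageIndex a k 0 x ≤ r * vol a i ↔ pageIndex a k i x ≤ r := by
  induction i generalizing r with
  | zero => simp [vol_zero]
  | succ i ih =>
    rw [vol_succ, ← pageIndex_le_mul_iff hx hi, ← ih (by omega)]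
    ring_nf

/-- A `0`-page is a single point. Two points neither of which precedes the other agree in every
coordinate, and surjectivity follows by counting. -/
theorem pageIndex_zero_bijOn (a : ℕ → ℕ) (k : ℕ) :
    Set.BijOn (pageIndex a k 0) (grid a k) (Set.Icc 1 (vol a k)) := by
  have hm : Set.MapsTo (pageIndex a k 0) (grid a k) (Set.Icc 1 (vol a k)) := by
    intro x hx
    refine ⟨pageIndex_pos _ _ _ _, ?_⟩
    have := pageIndex_le_numPages hx (Nat.zero_le k)
    rwa [← mul_one (numPages _ _ _), ← vol_zero a, numPages_mul_vol (Nat.zero_le k)] at this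
  have hi : Set.InjOn (pageIndex a k 0) (grid a k) := by
    intro x hx y hy h
    by_contra hne
    have key : ∀ x ∈ grid a k, ∀ y ∈ grid a k,
        (pageIndex a k 0 x < pageIndex a k 0 y ↔ pageLT k 0 x y) := by
      intro x hx y hy
      have := pageIndex_lt_iff a 0 k x y (fun t h1 h2 => hx.1 t (by omega) (by omega))
        fun t h1 h2 => hy.1 t (by omega) (by omega)
      rwa [zero_add] at this
    have h1 := (key x hx y hy).not.1 (by omega)
    have h2 := (key y hy x hx).not.1 (by omega)
    -- Induction from the top coordinate downwards: a largest index of disagreement would order the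
    -- two points.
    have h3 : ∀ n, ∀ q, k < q + n → x q = y q := by
      intro n
      induction n with
      | zero => intro q hq; rw [hx.2 q (by omega), hy.2 q (by omega)]
      | succ n ih =>
        intro q hq
        rcases Nat.eq_zero_or_pos q with h0 | h0
        · rw [hx.2 q (by omega), hy.2 q (by omega)]
        by_cases h4 : q ≤ k
        · by_contra h5
          rcases Nat.lt_or_gt_of_ne h5 with h6 | h6
          · exact h1 ⟨q, h0, h4, h6, fun p hp _ => ih p (by omega)⟩
          · exact h2 ⟨q, h0, h4, h6, fun p hp _ => (ih p (by omega)).symm⟩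
        · rw [hx.2 q (by omega), hy.2 q (by omega)]
    exact hne (funext fun q => h3 (k + 1) q (by omega))
  refine ⟨hm, hi, ?_⟩
  have h1 : pageIndex a k 0 '' grid a k = Set.Icc 1 (vol a k) := by
    refine Set.eq_of_subset_of_ncard_le hm.image_subset ?_ (Set.finite_Icc _ _)
    rw [hi.ncard_image, ncard_grid]
    simp [← Finset.coe_Icc]
  exact h1.symm.subset

theorem mem_pagesUpTo {a : ℕ → ℕ} {k i r : ℕ} {x : Pt} :
    x ∈ pagesUpTo a k i r ↔ x ∈ grid a k ∧ pageIndex a k i x ≤ r := by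
  simp only [pagesUpTo, page, Set.mem_iUnion, Set.mem_Icc, Set.mem_ofPred_eq, exists_prop]
  constructor
  · rintro ⟨j, hj, hx, rfl⟩
    exact ⟨hx, hj.2⟩
  · rintro ⟨hx, h⟩
    exact ⟨_, ⟨pageIndex_pos _ _ _ _, h⟩, hx, rfl⟩

theorem ncard_pagesUpTo {a : ℕ → ℕ} {k i r : ℕ} (hi : i ≤ k) (hr : r ≤ numPages a k i) :
    (pagesUpTo a k i r).ncard = r * vol a i := by
  have hb := pageIndex_zero_bijOn a k
  have h1 : pageIndex a k 0 '' pagesUpTo a k i r = Set.Icc 1 (r * vol a i) := by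
    ext m
    constructor
    · rintro ⟨x, hx, rfl⟩
      rw [mem_pagesUpTo] at hx
      exact ⟨pageIndex_pos _ _ _ _, (pageIndex_zero_le_iff hx.1 hi r).2 hx.2⟩
    · rintro ⟨h1, h2⟩
      have h3 : r * vol a i ≤ vol a k := by
        rw [← numPages_mul_vol hi]; exact Nat.mul_le_mul_right _ hr
      obtain ⟨x, hx, rfl⟩ := hb.surjOn ⟨h1, h2.trans h3⟩
      exact ⟨x, mem_pagesUpTo.2 ⟨hx, (pageIndex_zero_le_iff hx hi r).1 h2⟩, rfl⟩
  have h2 : Set.InjOn (pageIndex a k 0) (pagesUpTo a k i r) :=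
    hb.injOn.mono fun x hx => (mem_pagesUpTo.1 hx).1
  rw [← h2.ncard_image, h1]
  simp [← Finset.coe_Icc]

/-! ### Grids in hypercubes -/

theorem cubeAdj.symm {v w : List Bool} (h : cubeAdj v w) : cubeAdj w v := by
  obtain ⟨s, b, t, rfl, rfl⟩ := h
  exact ⟨s, !b, t, rfl, by simp⟩

theorem cubeAdj.append_left {v w : List Bool} (u : List Bool) (h : cubeAdj v w) :
    cubeAdj (u ++ v) (u ++ w) := by
  obtain ⟨s, b, t, rfl, rfl⟩ := h
  exact ⟨u ++ s, b, t, by simp, by simp⟩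

theorem cubeAdj.append_right {v w : List Bool} (u : List Bool) (h : cubeAdj v w) :
    cubeAdj (v ++ u) (w ++ u) := by
  obtain ⟨s, b, t, rfl, rfl⟩ := h
  exact ⟨s, b, t ++ u, by simp, by simp⟩

/-- Gray codes: the path on `2 ^ t` vertices spans the hypercube of dimension `t`. -/
theorem exists_gray_code (t : ℕ) : ∃ g : ℕ → List Bool, Set.BijOn g (Set.Icc 1 (2 ^ t)) (cube t) ∧
    ∀ n, 1 ≤ n → n + 1 ≤ 2 ^ t → cubeAdj (g n) (g (n + 1)) := by
  induction t with
  | zero =>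
    refine ⟨fun _ => [], ⟨fun _ _ => rfl, ?_, ?_⟩, fun n h1 h2 => by simp at h2; omega⟩
    · rintro x ⟨h1, h2⟩ y ⟨h3, h4⟩ -
      simp at h2 h4
      omega
    · intro w hw
      exact ⟨1, by simp, (List.length_eq_zero_iff.1 hw).symm⟩
  | succ t ih =>
    obtain ⟨g, ⟨hm, hi, hs⟩, hg⟩ := ih
    have e : 2 ^ (t + 1) = 2 ^ t + 2 ^ t := by ring
    -- The reflected code: the second half runs backwards, so only the leading bit changes at the
    -- junction.
    refine ⟨fun n => if n ≤ 2 ^ t then false :: g n else true :: g (2 ^ (t + 1) + 1 - n),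
      ⟨?_, ?_, ?_⟩, ?_⟩
    · rintro n ⟨h1, h2⟩
      have h3 : n ≤ 2 ^ t → (g n).length = t := fun h => hm ⟨h1, h⟩
      have h4 : ¬ n ≤ 2 ^ t → (g (2 ^ (t + 1) + 1 - n)).length = t :=
        fun h => hm ⟨by omega, by omega⟩
      show List.length (if n ≤ 2 ^ t then _ else _) = t + 1
      split_ifs with h
      · simp [h3 h]
      · simp [h4 h]
    · rintro n ⟨h1, h2⟩ m ⟨h3, h4⟩ h
      simp only at h
      split_ifs at h with h5 h6 h6
      · simp only [List.cons.injEq, true_and] at h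
        exact hi ⟨h1, h5⟩ ⟨h3, h6⟩ h
      · simp at h
      · simp at h
      · simp only [List.cons.injEq, true_and] at h
        have := hi ⟨by omega, by omega⟩ ⟨by omega, by omega⟩ h
        omega
    · intro w hw
      obtain ⟨b, v, rfl⟩ : ∃ b v, w = b :: v := by
        cases w with
        | nil => simp [cube] at hw
        | cons b v => exact ⟨b, v, rfl⟩
      have hv : v ∈ cube t := by simpa [cube] using hw
      obtain ⟨n, ⟨h1, h2⟩, rfl⟩ := hs hv
      cases b with
      | false => exact ⟨n, ⟨h1, by omega⟩, by simp [h2]⟩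
      | true =>
        refine ⟨2 ^ (t + 1) + 1 - n, ⟨by omega, by omega⟩, ?_⟩
        have h3 : ¬ 2 ^ (t + 1) + 1 - n ≤ 2 ^ t := by omega
        have h4 : 2 ^ (t + 1) + 1 - (2 ^ (t + 1) + 1 - n) = n := by omega
        simp only [h3, if_false, h4]
    · intro n h1 h2
      simp only
      split_ifs with h3 h4 h4
      · exact (hg n h1 h4).append_left [false]
      · have h5 : 2 ^ (t + 1) + 1 - (n + 1) = n := by omega
        rw [h5]
        exact ⟨[], false, g n, rfl, rfl⟩
      · omega
      · have h5 : 2 ^ (t + 1) + 1 - n = 2 ^ (t + 1) + 1 - (n + 1) + 1 := by omega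
        rw [h5]
        exact (hg _ (by omega) (by omega)).symm.append_left [true]

theorem append_mem_cube {m n : ℕ} {v w : List Bool} (hv : v ∈ cube m) (hw : w ∈ cube n) :
    v ++ w ∈ cube (m + n) := by
  simp only [cube, Set.mem_ofPred_eq] at *
  simp [hv, hw]

/-- Concatenate one Gray code per coordinate: a grid edge moves one coordinate by one step, hence
flips one bit of one block. -/
theorem box_isSpanningSubgraphOfCube (m : ℕ → ℕ) (d : ℕ) :
    IsSpanningSubgraphOfCube (box d fun q => 2 ^ m q) (∑ t ∈ Finset.Icc 1 d, m t) := by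
  induction d with
  | zero =>
    refine ⟨fun _ => [], ?_, ?_⟩
    · rw [box_zero]
      refine ⟨fun _ _ => by simp [cube], fun x hx y hy _ => hx.trans hy.symm, fun w hw => ?_⟩
      exact ⟨0, rfl, (List.length_eq_zero_iff.1 (by simpa [cube] using hw)).symm⟩
    · intro x hx y hy h
      rw [box_zero] at hx hy
      obtain ⟨q, h, -⟩ := h
      rw [hx, hy] at h
      simp at h
  | succ d ih =>
    obtain ⟨φ, ⟨hm, hi, hs⟩, hφ⟩ := ih
    obtain ⟨g, ⟨gm, gi, gs⟩, hg⟩ := exists_gray_code (m (d + 1))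
    have hsplit : ∀ x ∈ box (d + 1) (fun q => 2 ^ m q),
        Function.update x (d + 1) 0 ∈ box d (fun q => 2 ^ m q) ∧
          x (d + 1) ∈ Set.Icc 1 (2 ^ m (d + 1)) := by
      intro x hx
      rw [box_succ] at hx
      obtain ⟨⟨y, c⟩, ⟨hy, hc⟩, rfl⟩ := hx
      refine ⟨?_, by simpa using hc⟩
      have : y (d + 1) = 0 := hy.2 _ (by omega)
      simpa [← this] using hy
    rw [Finset.sum_Icc_succ_top (by omega)]
    refine ⟨fun x => φ (Function.update x (d + 1) 0) ++ g (x (d + 1)), ⟨?_, ?_, ?_⟩, ?_⟩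
    · intro x hx
      exact append_mem_cube (hm (hsplit x hx).1) (gm (hsplit x hx).2)
    · intro x hx y hy h
      have hx' := hsplit x hx
      have hy' := hsplit y hy
      have h1 := List.append_inj h ((hm hx'.1).trans (hm hy'.1).symm)
      have h2 := hi hx'.1 hy'.1 h1.1
      have h3 := gi hx'.2 hy'.2 h1.2
      funext q
      by_cases hq : q = d + 1
      · rw [hq, h3]
      · simpa [hq] using congrFun h2 q
    · intro w hw
      have hw' : w.length = ∑ t ∈ Finset.Icc 1 d, m t + m (d + 1) := hw
      obtain ⟨x, hx, hx'⟩ := hs (show w.take (∑ t ∈ Finset.Icc 1 d, m t) ∈ cube _ by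
        simp [cube, hw'])
      obtain ⟨c, hc, hc'⟩ := gs (show w.drop (∑ t ∈ Finset.Icc 1 d, m t) ∈ cube _ by
        simp [cube, hw'])
      refine ⟨Function.update x (d + 1) c, ?_, ?_⟩
      · rw [box_succ]
        exact ⟨(x, c), ⟨hx, hc⟩, rfl⟩
      · have : x (d + 1) = 0 := hx.2 _ (by omega)
        simp only [Function.update_idem, Function.update_self]
        rw [← this, Function.update_eq_self, hx', hc', List.take_append_drop]
    · rintro x hx y hy ⟨q, h1, h2⟩
      by_cases hq : q = d + 1
      · subst hq
        have h3 : Function.update x (d + 1) 0 = Function.update y (d + 1) 0 := by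
          funext q
          by_cases hq : q = d + 1
          · simp [hq]
          · simpa [hq] using h2 q hq
        simp only [h3]
        refine cubeAdj.append_left _ ?_
        have hx' := (hsplit x hx).2
        have hy' := (hsplit y hy).2
        rcases h1 with h1 | h1
        · rw [← h1] at hy' ⊢
          exact hg _ hx'.1 hy'.2
        · rw [← h1] at hx' ⊢
          exact (hg _ hy'.1 hx'.2).symm
      · have h3 := h2 (d + 1) (Ne.symm hq)
        simp only [h3]
        refine cubeAdj.append_right _ (hφ _ (hsplit x hx).1 _ (hsplit y hy).1 ⟨q, ?_, ?_⟩)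
        · simpa [hq] using h1
        · intro r hr
          by_cases hq' : r = d + 1
          · simp [hq']
          · simpa [hq'] using h2 r hr

/-! ### The two-dimensional map -/

/-- `⌊m · 2 ^ e₁ / a 1⌋`, the floor that governs the chains of the two-dimensional map. -/
def chainFloor (a : ℕ → ℕ) (m : ℤ) : ℤ := m * 2 ^ expo a 1 / a 1

theorem vol_one (a : ℕ → ℕ) : vol a 1 = a 1 := by simp [vol]

theorem le_two_pow_expo_one (a : ℕ → ℕ) : a 1 ≤ 2 ^ expo a 1 := by
  have := vol_le_two_pow_expo a 1
  rwa [vol_one] at this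

theorem two_pow_expo_one_lt {a : ℕ → ℕ} (h : 1 ≤ a 1) : 2 ^ expo a 1 < 2 * a 1 := by
  have := two_pow_expo_lt (a := a) (i := 1) (by rwa [vol_one])
  rwa [vol_one] at this

theorem mul_chainFloor_le {a : ℕ → ℕ} (h : 1 ≤ a 1) (m : ℤ) :
    a 1 * chainFloor a m ≤ m * 2 ^ expo a 1 :=
  Int.mul_ediv_self_le (by omega)

theorem lt_mul_chainFloor_add {a : ℕ → ℕ} (h : 1 ≤ a 1) (m : ℤ) :
    m * 2 ^ expo a 1 < a 1 * chainFloor a m + a 1 :=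
  Int.lt_mul_ediv_self_add (by omega)

/-- This quasi-periodicity is what makes the cyclic shift of the rows harmless. Integer arguments
are needed because `i - j` becomes negative. -/
theorem chainFloor_add {a : ℕ → ℕ} (h : 1 ≤ a 1) (m : ℤ) :
    chainFloor a (m + a 1) = chainFloor a m + 2 ^ expo a 1 := by
  unfold chainFloor
  rw [add_mul, mul_comm (a 1 : ℤ), Int.add_mul_ediv_right _ _ (by omega)]

/-- Consecutive floors differ by `1` or `2` because the slope lies in $[1,2)$; the next lemma is the
other half. -/
theorem chainFloor_succ_ge {a : ℕ → ℕ} (h : 1 ≤ a 1) (m : ℤ) :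
    chainFloor a m + 1 ≤ chainFloor a (m + 1) := by
  have h1 := mul_chainFloor_le h m
  have h2 := lt_mul_chainFloor_add h (m + 1)
  have h3 : ((a 1 : ℕ) : ℤ) ≤ 2 ^ expo a 1 := by exact_mod_cast le_two_pow_expo_one a
  have h4 : (a 1 : ℤ) * chainFloor a m < a 1 * chainFloor a (m + 1) := by
    rw [add_mul] at h2
    linarith
  exact lt_of_mul_lt_mul_left h4 (by omega)

theorem chainFloor_succ_le {a : ℕ → ℕ} (h : 1 ≤ a 1) (m : ℤ) :
    chainFloor a (m + 1) ≤ chainFloor a m + 2 := by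
  have h1 := lt_mul_chainFloor_add h m
  have h2 := mul_chainFloor_le h (m + 1)
  have h3 : (2 : ℤ) ^ expo a 1 < 2 * a 1 := by exact_mod_cast two_pow_expo_one_lt h
  have h4 : (a 1 : ℤ) * chainFloor a (m + 1) < a 1 * (chainFloor a m + 3) := by
    rw [add_mul] at h2
    linarith
  have := lt_of_mul_lt_mul_left h4 (by omega)
  omega

/-- The slope $\rho$ is $\alpha-1$, so its floors differ from those of $\alpha$ by the integer `m`.
-/
theorem natFloor_slope_mul {a : ℕ → ℕ} (h : 1 ≤ a 1) {m : ℤ} (hm : 0 ≤ m) :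
    (⌊((2 : ℚ) ^ expo a 1 - a 1) / a 1 * (m : ℚ)⌋₊ : ℤ) = chainFloor a m - m := by
  have h0 : (0 : ℚ) < a 1 := by exact_mod_cast h
  have h3 : ((a 1 : ℕ) : ℚ) ≤ 2 ^ expo a 1 := by exact_mod_cast le_two_pow_expo_one a
  have h4 : (0 : ℚ) ≤ m := by exact_mod_cast hm
  have h1 : (a 1 : ℚ) * chainFloor a m ≤ m * 2 ^ expo a 1 := by
    exact_mod_cast mul_chainFloor_le h m
  have h2 : (m : ℚ) * 2 ^ expo a 1 < a 1 * chainFloor a m + a 1 := by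
    exact_mod_cast lt_mul_chainFloor_add h m
  have h5 : (0 : ℚ) ≤ ((2 : ℚ) ^ expo a 1 - a 1) / a 1 * (m : ℚ) :=
    mul_nonneg (div_nonneg (by linarith) h0.le) h4
  rw [Int.natCast_floor_eq_floor h5, Int.floor_eq_iff]
  have h6 : ((2 : ℚ) ^ expo a 1 - a 1) / a 1 * (m : ℚ) = m * 2 ^ expo a 1 / a 1 - m := by
    field_simp
  rw [h6]
  push_cast
  constructor
  · have : (chainFloor a m : ℚ) ≤ m * 2 ^ expo a 1 / a 1 := by
      rw [le_div_iff₀ h0]; linarith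
    linarith
  · have : m * 2 ^ expo a 1 / a 1 < (chainFloor a m : ℚ) + 1 := by
      rw [div_lt_iff₀ h0]; linarith
    linarith

/-- A downward shift translates the argument of the floor; the wrap from row `1` to row `a 1` costs
a full period, which cancels in the difference. -/
theorem shiftMatrix_eq {a : ℕ → ℕ} (h : 1 ≤ a 1) (j : ℕ) {i : ℕ} (hi : 1 ≤ i) (hi' : i ≤ a 1) :
    (shiftMatrix a (j + 1) i : ℤ) = chainFloor a (i - j) - chainFloor a (i - j - 1) - 1 := by
  induction j generalizing i with
  | zero =>
    have h1 := natFloor_slope_mul h (m := i) (by omega)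
    have h2 := natFloor_slope_mul h (m := (i : ℤ) - 1) (by omega)
    have h3 := chainFloor_succ_ge h ((i : ℤ) - 1)
    rw [sub_add_cancel] at h3
    push_cast at h1 h2
    rw [zero_add, shiftMatrix, Nat.cast_sub (by omega), h1, h2]
    push_cast
    ring_nf
  | succ j ih =>
    rw [shiftMatrix]
    split_ifs with h1
    · rw [ih h le_rfl, h1]
      have h2 := chainFloor_add h (-j)
      have h3 := chainFloor_add h (-j - 1)
      rw [show -(j : ℤ) + a 1 = a 1 - j by ring] at h2
      rw [show -(j : ℤ) - 1 + a 1 = a 1 - j - 1 by ring] at h3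
      rw [h2, h3]
      push_cast
      ring_nf
    · rw [ih (by omega) (by omega), Nat.cast_sub hi]
      push_cast
      ring_nf

theorem shiftMatrix_le_one {a : ℕ → ℕ} (h : 1 ≤ a 1) (j : ℕ) {i : ℕ} (hi : 1 ≤ i)
    (hi' : i ≤ a 1) : shiftMatrix a j i ≤ 1 := by
  cases j with
  | zero => simp [shiftMatrix]
  | succ j =>
    have h1 := shiftMatrix_eq h j hi hi'
    have h2 := chainFloor_succ_le h ((i : ℤ) - j - 1)
    rw [sub_add_cancel] at h2
    omega

theorem chainCount_zero (a : ℕ → ℕ) (i : ℕ) : chainCount a i 0 = 0 := by simp [chainCount]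

theorem chainCount_succ (a : ℕ → ℕ) (i j : ℕ) :
    chainCount a i (j + 1) = chainCount a i j + (1 + shiftMatrix a (j + 1) i) := by
  unfold chainCount
  rw [Finset.sum_Icc_succ_top (by omega)]
  ring

theorem chainCount_strictMono (a : ℕ → ℕ) (i : ℕ) : StrictMono (chainCount a i) :=
  strictMono_nat_of_lt_succ fun j => by rw [chainCount_succ]; omega

/-- The arguments `i - j` in row `i` are consecutive integers, so the row sum telescopes. -/
theorem chainCount_eq {a : ℕ → ℕ} (h : 1 ≤ a 1) (j : ℕ) {i : ℕ} (hi : 1 ≤ i) (hi' : i ≤ a 1) :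
    (chainCount a i j : ℤ) = chainFloor a i - chainFloor a (i - j) := by
  induction j with
  | zero => simp [chainCount_zero]
  | succ j ih =>
    rw [chainCount_succ]
    push_cast
    rw [ih, shiftMatrix_eq h j hi hi']
    ring_nf

/-- With the next lemma: a difference of two floors is within `1` of the difference $j\alpha$ of
their arguments, uniformly in the chain. -/
theorem mul_chainCount_lt {a : ℕ → ℕ} (h : 1 ≤ a 1) (j : ℕ) {i : ℕ} (hi : 1 ≤ i)
    (hi' : i ≤ a 1) : a 1 * chainCount a i j < j * 2 ^ expo a 1 + a 1 := by
  have h1 := mul_chainFloor_le h i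
  have h2 := lt_mul_chainFloor_add h (i - j)
  have h3 := chainCount_eq h j hi hi'
  zify
  rw [h3, mul_sub]
  rw [sub_mul] at h2
  linarith

theorem lt_mul_chainCount_add {a : ℕ → ℕ} (h : 1 ≤ a 1) (j : ℕ) {i : ℕ} (hi : 1 ≤ i)
    (hi' : i ≤ a 1) : j * 2 ^ expo a 1 < a 1 * chainCount a i j + a 1 := by
  have h1 := lt_mul_chainFloor_add h i
  have h2 := mul_chainFloor_le h (i - j)
  have h3 := chainCount_eq h j hi hi'
  zify
  rw [h3, mul_sub]
  rw [sub_mul] at h2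
  linarith

/-- The number of positions of column `j` that are taken by the first `i` chains. -/
def columnCount (a : ℕ → ℕ) (j i : ℕ) : ℕ := ∑ t ∈ Finset.Icc 1 i, (1 + shiftMatrix a j t)

theorem columnCount_zero (a : ℕ → ℕ) (j : ℕ) : columnCount a j 0 = 0 := by simp [columnCount]

theorem columnCount_succ (a : ℕ → ℕ) (j i : ℕ) :
    columnCount a j (i + 1) = columnCount a j i + (1 + shiftMatrix a j (i + 1)) :=
  Finset.sum_Icc_succ_top (by omega) _

theorem columnCount_strictMono (a : ℕ → ℕ) (j : ℕ) : StrictMono (columnCount a j) :=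
  strictMono_nat_of_lt_succ fun i => by rw [columnCount_succ]; omega

theorem columnCount_eq {a : ℕ → ℕ} (h : 1 ≤ a 1) (j : ℕ) {i : ℕ} (hi' : i ≤ a 1) :
    (columnCount a (j + 1) i : ℤ) = chainFloor a (i - j) - chainFloor a (-j) := by
  induction i with
  | zero => simp [columnCount_zero]
  | succ i ih =>
    rw [columnCount_succ]
    push_cast
    rw [ih (by omega), shiftMatrix_eq h j (by omega) hi']
    push_cast
    ring_nf

/-- A column sum telescopes over one full period, so every column of the two-dimensional image is
exactly full. -/
theorem columnCount_top {a : ℕ → ℕ} (h : 1 ≤ a 1) {j : ℕ} (hj : 1 ≤ j) :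
    columnCount a j (a 1) = 2 ^ expo a 1 := by
  obtain ⟨j, rfl⟩ : ∃ t, j = t + 1 := ⟨j - 1, by omega⟩
  have h1 := columnCount_eq h j le_rfl
  have h2 := chainFloor_add h (-j)
  rw [show -(j : ℤ) + a 1 = a 1 - j by ring] at h2
  zify
  linarith

/-- `chainCount` is strictly increasing, hence unbounded, so the infimum is attained and the two
functions form a Galois connection. -/
theorem chainCol_le_iff (a : ℕ → ℕ) (i y J : ℕ) : chainCol a i y ≤ J ↔ y ≤ chainCount a i J := by
  constructor
  · intro h
    have h1 : chainCol a i y ∈ {j | y ≤ chainCount a i j} :=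
      Nat.sInf_mem ⟨y, (chainCount_strictMono a i).le_apply⟩
    exact le_trans h1 ((chainCount_strictMono a i).monotone h)
  · intro h
    exact Nat.sInf_le h

theorem chainCol_eq_iff (a : ℕ → ℕ) (i y j : ℕ) :
    chainCol a i y = j + 1 ↔ chainCount a i j < y ∧ y ≤ chainCount a i (j + 1) := by
  rw [← chainCol_le_iff, ← not_le, ← chainCol_le_iff]
  omega

theorem chainCol_pos {a : ℕ → ℕ} {i y : ℕ} (hy : 1 ≤ y) : 1 ≤ chainCol a i y := by
  by_contra h
  have := (chainCol_le_iff a i y 0).1 (by omega)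
  rw [chainCount_zero] at this
  omega

/-- The position of the `y`-th point of chain `i`, as the offset of the chain in its column plus
the position among the (one or two) points of the chain there. -/
theorem chainRow_eq {a : ℕ → ℕ} (h : 1 ≤ a 1) {i y j : ℕ} (hi : 1 ≤ i) (hi' : i ≤ a 1)
    (hj : chainCol a i y = j + 1) :
    chainRow a i y = columnCount a (j + 1) (i - 1) +
      if shiftMatrix a (j + 1) i = 0 then 1
      else if Even (j + 1) then 3 - (y - chainCount a i j) else y - chainCount a i j := by
  have h1 := (chainCol_eq_iff a i y j).1 hj
  have h2 := shiftMatrix_le_one h (j + 1) hi hi'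
  simp only [chainRow, hj, Nat.add_sub_cancel, columnCount]
  rw [chainCount_succ] at h1
  split_ifs <;> try rfl
  omega

theorem chainRow_bounds {a : ℕ → ℕ} (h : 1 ≤ a 1) {i y j : ℕ} (hi : 1 ≤ i) (hi' : i ≤ a 1)
    (hj : chainCol a i y = j + 1) :
    columnCount a (j + 1) (i - 1) < chainRow a i y ∧
      chainRow a i y ≤ columnCount a (j + 1) i := by
  have h1 := (chainCol_eq_iff a i y j).1 hj
  have h2 := columnCount_succ a (j + 1) (i - 1)
  have h3 := shiftMatrix_le_one h (j + 1) hi hi'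
  rw [Nat.sub_add_cancel hi] at h2
  rw [chainCount_succ] at h1
  rw [h2, chainRow_eq h hi hi' hj]
  split_ifs <;> omega

/-- Chains occupy disjoint intervals of a column, so the position determines the chain; the at most
two points of a chain there have different positions. -/
theorem chain_injective {a : ℕ → ℕ} (h : 1 ≤ a 1) {i y i' y' : ℕ} (hi : 1 ≤ i) (hia : i ≤ a 1)
    (hi' : 1 ≤ i') (hia' : i' ≤ a 1) (hy : 1 ≤ y) (hrow : chainRow a i y = chainRow a i' y')
    (hcol : chainCol a i y = chainCol a i' y') : i = i' ∧ y = y' := by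
  obtain ⟨j, hj⟩ : ∃ j, chainCol a i y = j + 1 :=
    ⟨chainCol a i y - 1, by have := chainCol_pos (a := a) (i := i) hy; omega⟩
  have hj' := hj
  rw [hcol] at hj'
  have b1 := chainRow_bounds h hi hia hj
  have b2 := chainRow_bounds h hi' hia' hj'
  have hii : i = i' := by
    rcases lt_trichotomy i i' with h1 | h1 | h1
    · have := (columnCount_strictMono a (j + 1)).monotone (show i ≤ i' - 1 by omega)
      omega
    · exact h1
    · have := (columnCount_strictMono a (j + 1)).monotone (show i' ≤ i - 1 by omega)
      omega
  subst hii
  refine ⟨rfl, ?_⟩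
  have h1 := (chainCol_eq_iff a i y j).1 hj
  have h2 := (chainCol_eq_iff a i y' j).1 hj'
  have h3 := shiftMatrix_le_one h (j + 1) hi hia
  rw [chainCount_succ] at h1 h2
  rw [chainRow_eq h hi hia hj, chainRow_eq h hi hia hj'] at hrow
  split_ifs at hrow <;> omega

/-- Position `p` belongs to the least chain whose cumulative count in the column reaches `p`. -/
theorem chain_surjective {a : ℕ → ℕ} (h : 1 ≤ a 1) {p j : ℕ} (hp : 1 ≤ p)
    (hp' : p ≤ 2 ^ expo a 1) (hj : 1 ≤ j) :
    ∃ i y, 1 ≤ i ∧ i ≤ a 1 ∧ 1 ≤ y ∧ chainRow a i y = p ∧ chainCol a i y = j := by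
  have hex : ∃ i, p ≤ columnCount a j i := ⟨a 1, by rwa [columnCount_top h hj]⟩
  obtain ⟨i, hi, hmin⟩ : ∃ i, p ≤ columnCount a j i ∧ ∀ t, t < i → columnCount a j t < p := by
    classical
    exact ⟨Nat.find hex, Nat.find_spec hex, fun t ht => not_le.1 (Nat.find_min hex ht)⟩
  have hi1 : 1 ≤ i := by
    by_contra h0
    obtain rfl : i = 0 := by omega
    rw [columnCount_zero] at hi
    omega
  have hia : i ≤ a 1 := by
    by_contra h0
    have := hmin (a 1) (by omega)
    rw [columnCount_top h hj] at this
    omega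
  have h1 := hmin (i - 1) (by omega)
  obtain ⟨j, rfl⟩ : ∃ t, j = t + 1 := ⟨j - 1, by omega⟩
  have h2 := columnCount_succ a (j + 1) (i - 1)
  rw [Nat.sub_add_cancel hi1] at h2
  have h3 := shiftMatrix_le_one h (j + 1) hi1 hia
  have h4 := chainCount_succ a i j
  -- `d` is the rank of the wanted point within its chain in this column; in the reversed case it is
  -- read off by the involution `d ↦ 3 - d`.
  have key : ∃ d, 1 ≤ d ∧ d ≤ 1 + shiftMatrix a (j + 1) i ∧
      p = columnCount a (j + 1) (i - 1) +
        if shiftMatrix a (j + 1) i = 0 then 1 else if Even (j + 1) then 3 - d else d := by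
    by_cases h5 : Even (j + 1) ∧ shiftMatrix a (j + 1) i ≠ 0
    · refine ⟨3 - (p - columnCount a (j + 1) (i - 1)), by omega, by omega, ?_⟩
      rw [if_neg h5.2, if_pos h5.1]
      omega
    · refine ⟨p - columnCount a (j + 1) (i - 1), by omega, by omega, ?_⟩
      split_ifs with h6 h7
      · omega
      · exact absurd ⟨h7, h6⟩ h5
      · omega
  obtain ⟨d, hd, hd', hpd⟩ := key
  have hc : chainCol a i (chainCount a i j + d) = j + 1 := by
    rw [chainCol_eq_iff]
    omega
  refine ⟨i, chainCount a i j + d, hi1, hia, by omega, ?_, hc⟩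
  rw [chainRow_eq h hi1 hia hc, Nat.add_sub_cancel_left, hpd]

theorem width_one (a : ℕ → ℕ) : width a 1 = 2 ^ expo a 1 := by simp [width, expo_zero]

theorem grid_ext {a : ℕ → ℕ} {k : ℕ} (hk : 1 ≤ k) {x y : Pt} (hx : x ∈ grid a k)
    (hy : y ∈ grid a k) (h1 : x 1 = y 1) (h2 : pageIndex a k 1 x = pageIndex a k 1 y) : x = y := by
  refine (pageIndex_zero_bijOn a k).injOn hx hy ?_
  rw [pageIndex_eq_add_mul hx (by omega), pageIndex_eq_add_mul hy (by omega), zero_add, h1, h2]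

theorem exists_mem_grid {a : ℕ → ℕ} {k : ℕ} (hk : 1 ≤ k) {i y : ℕ} (hi : 1 ≤ i) (hi' : i ≤ a 1)
    (hy : 1 ≤ y) (hy' : y ≤ numPages a k 1) :
    ∃ x ∈ grid a k, x 1 = i ∧ pageIndex a k 1 x = y := by
  obtain ⟨z, rfl⟩ : ∃ z, y = z + 1 := ⟨y - 1, by omega⟩
  have h1 : i + a 1 * z ≤ vol a k := by
    have := numPages_mul_vol (a := a) hk
    rw [vol_one] at this
    rw [← this]
    calc i + a 1 * z ≤ (z + 1) * a 1 := by rw [add_mul, mul_comm]; omega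
      _ ≤ _ := Nat.mul_le_mul_right _ hy'
  obtain ⟨x, hx, hx'⟩ := (pageIndex_zero_bijOn a k).surjOn
    (show i + a 1 * z ∈ Set.Icc 1 (vol a k) from ⟨by omega, h1⟩)
  refine ⟨x, hx, ?_⟩
  rw [pageIndex_eq_add_mul hx (by omega), zero_add] at hx'
  have h2 := hx.1 1 le_rfl hk
  have h3 := pageIndex_pos a k 1 x
  have h4 : (x 1 - 1) % a 1 = (i - 1) % a 1 := by
    have : (x 1 - 1) + a 1 * (pageIndex a k 1 x - 1) = (i - 1) + a 1 * z := by omega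
    have := congrArg (· % a 1) this
    simpa using this
  rw [Nat.mod_eq_of_lt (by omega), Nat.mod_eq_of_lt (by omega)] at h4
  have h5 : x 1 = i := by omega
  refine ⟨h5, ?_⟩
  rw [h5] at hx'
  have : pageIndex a k 1 x - 1 = z := Nat.eq_of_mul_eq_mul_left (show 0 < a 1 by omega) (by omega)
  omega

/-- The least number of levels of `Y_i` that can hold the points of `r` many `i`-pages. -/
noncomputable def pageLevels (a : ℕ → ℕ) (i r : ℕ) : ℕ :=
  ⌈((r * vol a i : ℕ) : ℚ) / 2 ^ expo a (i - 1)⌉₊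

/-- The map `f` is injective, sends the first `r` many `i`-pages of the grid to the least possible
number of levels of `Y_i`, and fills one level more by the next page. -/
structure FillsPages (a : ℕ → ℕ) (k i : ℕ) (f : Pt → Pt) : Prop where
  injOn : Set.InjOn f (grid a k)
  mem : ∀ x ∈ grid a k, ∀ r, pageIndex a k i x ≤ r → f x ∈ levelsUpTo a i (pageLevels a i r)
  exists_eq : ∀ r, 1 ≤ r → r + 1 ≤ numPages a k i →
    ∀ y ∈ levelsUpTo a i (pageLevels a i r + 1),
      ∃ x ∈ grid a k, pageIndex a k i x ≤ r + 1 ∧ f x = y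

theorem pageLevels_le_iff {a : ℕ → ℕ} {i r m : ℕ} :
    pageLevels a i r ≤ m ↔ r * vol a i ≤ m * 2 ^ expo a (i - 1) := ceil_div_two_pow_le

theorem le_pageLevels_mul (a : ℕ → ℕ) (i r : ℕ) :
    r * vol a i ≤ pageLevels a i r * 2 ^ expo a (i - 1) := pageLevels_le_iff.1 le_rfl

theorem pageLevels_mul_lt (a : ℕ → ℕ) (i r : ℕ) :
    pageLevels a i r * 2 ^ expo a (i - 1) < r * vol a i + 2 ^ expo a (i - 1) :=
  ceil_mul_two_pow_lt _ _

theorem pageLevels_mono {a : ℕ → ℕ} {i r s : ℕ} (h : r ≤ s) :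
    pageLevels a i r ≤ pageLevels a i s := ceil_div_two_pow_mono (Nat.mul_le_mul_right _ h)

/-- The first $r$ of the `2`-pages contain the first $ra_2$ points of each chain, and $j$ columns
take $j\alpha\pm1$ points of a chain. Both level bounds compare these two numbers. -/
theorem f₂_fillsPages {a : ℕ → ℕ} {k : ℕ} (hk : 2 ≤ k) (ha : ∀ i, 1 ≤ i → i ≤ k → 2 ^ 22 ≤ a i) :
    FillsPages a k 2 (f₂ a k) := by
  have h1 : 1 ≤ a 1 := (by norm_num : 1 ≤ 2 ^ 22).trans (ha 1 le_rfl (by omega))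
  have e1 : ∀ x, f₂ a k x 1 = chainRow a (x 1) (pageIndex a k 1 x) := fun x => by simp [f₂]
  have e2 : ∀ x, f₂ a k x 2 = chainCol a (x 1) (pageIndex a k 1 x) := fun x => by simp [f₂]
  have e3 : ∀ x q, q ≠ 1 → q ≠ 2 → f₂ a k x q = 0 := fun x q h h' => by simp [f₂, h, h']
  have hvol : vol a 2 = a 1 * a 2 := by rw [vol_succ, vol_one]
  have hE := two_pow_expo_one_lt h1
  refine ⟨?_, ?_, ?_⟩
  · intro x hx y hy hxy
    have hx1 := hx.1 1 le_rfl (by omega)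
    have hy1 := hy.1 1 le_rfl (by omega)
    have c1 := congrFun hxy 1
    have c2 := congrFun hxy 2
    rw [e1, e1] at c1
    rw [e2, e2] at c2
    obtain ⟨h2, h3⟩ := chain_injective h1 hx1.1 hx1.2 hy1.1 hy1.2 (pageIndex_pos _ _ _ _) c1 c2
    exact grid_ext (by omega) hx hy h2 h3
  · intro x hx r hr
    have hx1 := hx.1 1 le_rfl (by omega)
    have hp := pageIndex_pos a k 1 x
    have hcol := chainCol_pos (a := a) (i := x 1) hp
    refine ⟨⟨fun q hq hq' => ?_, by rwa [e2], fun q hq => e3 x q (by omega) (by omega)⟩, ?_⟩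
    · obtain rfl : q = 1 := by omega
      obtain ⟨j, hj⟩ : ∃ j, chainCol a (x 1) (pageIndex a k 1 x) = j + 1 :=
        ⟨_, (Nat.sub_add_cancel hcol).symm⟩
      have hb := chainRow_bounds h1 hx1.1 hx1.2 hj
      have := (columnCount_strictMono a (j + 1)).monotone hx1.2
      rw [columnCount_top h1 (by omega)] at this
      rw [e1, width_one]
      omega
    · rw [e2, chainCol_le_iff]
      have h2 := (pageIndex_le_mul_iff hx (i := 1) hk r).2 hr
      have h3 := lt_mul_chainCount_add h1 (pageLevels a 2 r) hx1.1 hx1.2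
      have h4 : r * (a 1 * a 2) ≤ _ := hvol ▸ le_pageLevels_mul a 2 r
      refine h2.trans (Nat.le_of_lt_succ ?_)
      refine Nat.lt_of_mul_lt_mul_left (a := a 1) ?_
      calc a 1 * (r * a (1 + 1)) = r * (a 1 * a 2) := by ring
        _ ≤ _ := h4
        _ < _ := h3
        _ = _ := by rw [Nat.succ_eq_add_one]; ring
  · rintro r hr hr' y ⟨⟨hy1, hy2, hy3⟩, hy4⟩
    have hy1 := hy1 1 le_rfl (by omega)
    rw [width_one] at hy1
    obtain ⟨i, p, hi, hi', hp, hrow, hcol⟩ := chain_surjective h1 hy1.1 hy1.2 hy2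
    have h2 := (chainCol_le_iff a i p _).1 (hcol.le.trans hy4)
    have h3 := mul_chainCount_lt h1 (pageLevels a 2 r + 1) hi hi'
    have h4 := pageLevels_mul_lt a 2 r
    rw [hvol] at h4
    -- The `5` collects `2 ^ expo a 1 < 2 * a 1` twice, once for rounding up the number of levels
    -- and once for the extra level, and `a 1` for the chain error. One more page supplies `a 2`
    -- points per chain, far more than `5`.
    have h5 : a 1 * chainCount a i (pageLevels a 2 r + 1) < a 1 * (r * a 2 + 5) := by
      rw [show 2 - 1 = 1 from rfl] at h4
      calc _ < _ := h3
        _ = pageLevels a 2 r * 2 ^ expo a 1 + 2 ^ expo a 1 + a 1 := by ring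
        _ ≤ r * (a 1 * a 2) + 5 * a 1 := by omega
        _ = _ := by ring
    have h6 := Nat.lt_of_mul_lt_mul_left h5
    have h7 : 2 ^ 22 ≤ a 2 := ha 2 (by norm_num) hk
    have h8 : p ≤ (r + 1) * a 2 := by
      rw [add_mul]
      norm_num at h7
      omega
    have h9 : numPages a k 1 = a 2 * numPages a k 2 := numPages_eq_mul hk
    have h10 : p ≤ numPages a k 1 := by
      rw [h9, mul_comm]
      exact h8.trans (Nat.mul_le_mul_right _ hr')
    obtain ⟨x, hx, hx1, hx2⟩ := exists_mem_grid (k := k) (by omega) hi hi' hp h10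
    refine ⟨x, hx, (pageIndex_le_mul_iff hx (i := 1) hk _).1 (by rwa [hx2]), ?_⟩
    funext q
    by_cases q1 : q = 1
    · rw [q1, e1, hx1, hx2, hrow]
    by_cases q2 : q = 2
    · rw [q2, e2, hx1, hx2, hcol]
    rw [e3 x q q1 q2, hy3 q (by omega)]

/-! ### Blank levels -/

/-- The hypotheses under which the `i`-th inflation and stacking are analysed. -/
structure Admissible (a : ℕ → ℕ) (k : ℕ) (F : ℕ → ℕ → ℕ → ℤ) (i : ℕ) : Prop where
  two_le : 2 ≤ i
  lt : i + 1 ≤ k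
  le_side : ∀ t, 1 ≤ t → t ≤ k → 2 ^ 22 ≤ a t
  isBlankMatrix : IsBlankMatrix a k i (F i)

namespace Admissible

variable {a : ℕ → ℕ} {k : ℕ} {F : ℕ → ℕ → ℕ → ℤ} {i : ℕ}

theorem side_pos (h : Admissible a k F i) (t : ℕ) (h1 : 1 ≤ t) (h2 : t ≤ k) : 1 ≤ a t :=
  (by norm_num : 1 ≤ 2 ^ 22).trans (h.le_side t h1 h2)

theorem expo_mul_width (h : Admissible a k F i) :
    2 ^ expo a (i - 1) * width a i = 2 ^ expo a i :=
  two_pow_expo_mul_width (expo_le_expo h.side_pos (by omega) (by have := h.lt; omega))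

/-- A side of length at least `2` forces the exponent to grow. Evenness of the width sharpens the
next bound on the blank levels. -/
theorem exists_width_eq (h : Admissible a k F i) : ∃ v, width a i = 2 * v := by
  have h1 := h.lt
  have h2 := h.two_le
  obtain ⟨j, rfl⟩ : ∃ j, i = j + 1 := ⟨i - 1, by omega⟩
  have h3 : 1 ≤ vol a j := vol_pos fun t ht ht' => h.side_pos t ht (by omega)
  have h4 : expo a j < expo a (j + 1) := by
    have h5 := two_pow_expo_lt h3
    have h6 := vol_le_two_pow_expo a (j + 1)
    rw [vol_succ] at h6
    have h7 : 2 ≤ a (j + 1) := (by norm_num : 2 ≤ 2 ^ 22).trans (h.le_side _ (by omega) (by omega))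
    have h8 : 2 ^ expo a j < 2 ^ expo a (j + 1) := by nlinarith
    exact (Nat.pow_lt_pow_iff_right (by norm_num)).1 h8
  refine ⟨2 ^ (expo a (j + 1) - expo a j - 1), ?_⟩
  rw [width, Nat.add_sub_cancel, ← pow_succ']
  congr 1
  omega

theorem vol_pos (h : Admissible a k F i) : 1 ≤ vol a i :=
  GridEmbedding.vol_pos fun t ht ht' => h.side_pos t ht (by have := h.lt; omega)

theorem ratio_le (h : Admissible a k F i) : (vol a i : ℚ) / 2 ^ expo a (i - 1) ≤ width a i := by
  rw [div_le_iff₀ (by positivity), mul_comm]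
  exact_mod_cast h.expo_mul_width ▸ vol_le_two_pow_expo a i

theorem lt_two_mul_ratio (h : Admissible a k F i) :
    (width a i : ℚ) < 2 * ((vol a i : ℚ) / 2 ^ expo a (i - 1)) := by
  rw [← mul_div_assoc, lt_div_iff₀ (by positivity), mul_comm]
  exact_mod_cast h.expo_mul_width ▸ two_pow_expo_lt h.vol_pos

/-- Since $q>w/2$ with $w$ even, $\lceil q\rceil\ge w/2+1$; this spare unit pays for the one blank
level that the difference of floors may add. -/
theorem blankCount_bounds (h : Admissible a k F i) (c : ℕ) :
    0 ≤ blankCount a i c ∧ 2 * blankCount a i c ≤ width a i := by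
  obtain ⟨v, hv⟩ := h.exists_width_eq
  have h1 := h.ratio_le
  have h2 := h.lt_two_mul_ratio
  unfold blankCount blankSlope
  set q := (vol a i : ℚ) / 2 ^ expo a (i - 1)
  have h3 : ⌈q⌉ ≤ (width a i : ℤ) := Int.ceil_le.2 (by exact_mod_cast h1)
  have h4 : (v : ℤ) < ⌈q⌉ := by
    rw [Int.lt_ceil]
    rw [hv] at h2
    push_cast at h2 ⊢
    linarith
  have h5 := Int.le_ceil q
  have h6 := Int.ceil_lt_add_one q
  have h7 : ⌊((c : ℚ) - 1) * (⌈q⌉ - q)⌋ ≤ ⌊(c : ℚ) * (⌈q⌉ - q)⌋ :=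
    Int.floor_mono (by linarith)
  have h8 : ⌊(c : ℚ) * (⌈q⌉ - q)⌋ ≤ ⌊((c : ℚ) - 1) * (⌈q⌉ - q)⌋ + 1 := by
    rw [← Int.floor_add_one]
    exact Int.floor_mono (by linarith)
  rw [hv] at h3 ⊢
  push_cast at h3 ⊢
  constructor <;> linarith

theorem entry (h : Admissible a k F i) {c d : ℕ} (hc : c ∈ Finset.Icc 1 (numPages a k i))
    (hd : d ∈ Finset.Icc 1 (width a i)) : F i c d = 0 ∨ F i c d = 1 := by
  have h1 := h.blankCount_bounds c
  have hw : (0 : ℚ) < width a i := by exact_mod_cast width_pos a i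
  have h2 : (0 : ℚ) ≤ blankCount a i c / width a i :=
    div_nonneg (by exact_mod_cast h1.1) hw.le
  have h3 : (blankCount a i c / width a i : ℚ) < 1 := by
    rw [div_lt_one hw]
    have : blankCount a i c < width a i := by have := width_pos a i; omega
    exact_mod_cast this
  have h4 : ⌊(blankCount a i c / width a i : ℚ)⌋ = 0 := Int.floor_eq_zero_iff.2 ⟨h2, h3⟩
  have h5 : 0 ≤ ⌈(blankCount a i c / width a i : ℚ)⌉ := Int.ceil_nonneg h2
  have h6 : ⌈(blankCount a i c / width a i : ℚ)⌉ ≤ 1 := Int.ceil_le.2 (by exact_mod_cast h3.le)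
  rcases h.isBlankMatrix.1 c hc d hd with h7 | h7 <;> simp only at h7 <;> omega

theorem row_prefix (h : Admissible a k F i) {c b : ℕ} (hc : c ∈ Finset.Icc 1 (numPages a k i))
    (hb : b ≤ width a i) :
    |(b : ℚ) * (blankCount a i c / width a i) - ((∑ d ∈ Finset.Icc 1 b, F i c d : ℤ) : ℚ)| < 1 := by
  rcases Nat.eq_zero_or_pos b with rfl | hb0
  · simp
  have := h.isBlankMatrix.2.1 c hc b (Finset.mem_Icc.2 ⟨hb0, hb⟩)
  rw [Finset.sum_sub_distrib] at this
  simpa using this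

/-- The prescribed row sum is an integer, so a discrepancy below `1` vanishes. -/
theorem row_sum (h : Admissible a k F i) {c : ℕ} (hc : c ∈ Finset.Icc 1 (numPages a k i)) :
    ∑ d ∈ Finset.Icc 1 (width a i), F i c d = blankCount a i c := by
  have h1 := h.row_prefix hc le_rfl
  have hw : (width a i : ℚ) ≠ 0 := by exact_mod_cast (width_pos a i).ne'
  rw [mul_div_cancel₀ _ hw] at h1
  have h2 : |blankCount a i c - ∑ d ∈ Finset.Icc 1 (width a i), F i c d| < 1 := by exact_mod_cast h1
  have := Int.abs_lt_one_iff.1 h2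
  omega

theorem col_prefix (h : Admissible a k F i) {d b : ℕ} (hd : d ∈ Finset.Icc 1 (width a i))
    (hb : b ≤ numPages a k i) :
    |((∑ c ∈ Finset.Icc 1 b, blankCount a i c : ℤ) : ℚ) / width a i -
      ((∑ c ∈ Finset.Icc 1 b, F i c d : ℤ) : ℚ)| < 1 := by
  rcases Nat.eq_zero_or_pos b with rfl | hb0
  · simp
  have := h.isBlankMatrix.2.2.1 d hd b (Finset.mem_Icc.2 ⟨hb0, hb⟩)
  rw [Finset.sum_sub_distrib, ← Finset.sum_div] at this
  push_cast
  exact this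

/-- The floors telescope, and $r\lceil q\rceil-\lfloor r(\lceil q\rceil-q)\rfloor=\lceil rq\rceil$.
This is the purpose of the definition of $s_i$. -/
theorem sum_width_sub_blankCount (a : ℕ → ℕ) (i r : ℕ) :
    ∑ c ∈ Finset.Icc 1 r, ((width a i : ℤ) - blankCount a i c) = pageLevels a i r := by
  have h0 : (0 : ℚ) ≤ ((r * vol a i : ℕ) : ℚ) / 2 ^ expo a (i - 1) := by positivity
  rw [pageLevels, Int.natCast_ceil_eq_ceil h0]
  clear h0
  have h1 : ((r * vol a i : ℕ) : ℚ) / 2 ^ expo a (i - 1)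
      = r * ((vol a i : ℚ) / 2 ^ expo a (i - 1)) := by push_cast; ring
  rw [h1]
  unfold blankCount blankSlope
  set q := (vol a i : ℚ) / 2 ^ expo a (i - 1)
  have h2 : ∑ c ∈ Finset.Icc 1 r, ((width a i : ℤ) - ((width a i : ℤ) - ⌈q⌉
      + ⌊(c : ℚ) * (⌈q⌉ - q)⌋ - ⌊((c : ℚ) - 1) * (⌈q⌉ - q)⌋)) = r * ⌈q⌉ - ⌊(r : ℚ) * (⌈q⌉ - q)⌋ := by
    clear h1
    induction r with
    | zero => simp
    | succ r ih =>
      rw [Finset.sum_Icc_succ_top (by omega), ih]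
      push_cast
      rw [add_sub_cancel_right]
      ring
  rw [h2]
  have h3 : (r : ℚ) * q = ((r * ⌈q⌉ : ℤ) : ℚ) - r * (⌈q⌉ - q) := by push_cast; ring
  rw [h3, sub_eq_add_neg ((r * ⌈q⌉ : ℤ) : ℚ), Int.ceil_intCast_add, Int.ceil_neg, sub_eq_add_neg]

open Classical in
-- `Nat.count` looks strictly below its argument and level `0` is never nonblank, so the `+ 1` makes
-- this the count over levels `1, …, r * width a i + d`.
theorem count_nonblank (h : Admissible a k F i) {r d : ℕ} (hr : r < numPages a k i)
    (hd : d ≤ width a i) :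
    (Nat.count (Nonblank a k F i) (r * width a i + d + 1) : ℤ) =
      ∑ c ∈ Finset.Icc 1 r, ((width a i : ℤ) - blankCount a i c) + d
        - ∑ j ∈ Finset.Icc 1 d, F i (r + 1) j := by
  induction r generalizing d with
  | zero =>
    induction d with
    | zero => simp [Nat.count_succ, Nonblank]
    | succ d ih =>
      have h1 := ih (by omega)
      have h2 : Nonblank a k F i (0 * width a i + d + 1) ↔ F i 1 (d + 1) = 0 := by
        have : d + 1 ≤ numPages a k i * width a i := hd.trans (Nat.le_mul_of_pos_left _ hr)
        simp [Nonblank, this, Nat.div_eq_of_lt (show d < width a i by omega),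
          Nat.mod_eq_of_lt (show d < width a i by omega)]
      have h3 := h.entry (c := 1) (d := d + 1) (Finset.mem_Icc.2 ⟨le_rfl, hr⟩)
        (Finset.mem_Icc.2 ⟨by omega, hd⟩)
      rw [← add_assoc, Nat.count_succ, Finset.sum_Icc_succ_top (by omega)]
      push_cast
      rw [h1, if_congr h2 rfl rfl]
      split_ifs with h4
      · rw [zero_add, h4]; ring
      · rw [zero_add, h3.resolve_left h4]; ring
  | succ r ihr =>
    induction d with
    | zero =>
      have h1 := ihr (by omega) (le_refl (width a i))
      rw [h.row_sum (Finset.mem_Icc.2 ⟨by omega, hr.le⟩)] at h1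
      rw [show (r + 1) * width a i + 0 + 1 = r * width a i + width a i + 1 by ring, h1,
        Finset.sum_Icc_succ_top (by omega)]
      simp
      ring
    | succ d ih =>
      have h1 := ih (by omega)
      have h2 : Nonblank a k F i ((r + 1) * width a i + d + 1) ↔ F i (r + 1 + 1) (d + 1) = 0 := by
        have : (r + 1) * width a i + d + 1 ≤ numPages a k i * width a i := by
          calc _ ≤ (r + 1 + 1) * width a i := by rw [add_mul (r + 1)]; omega
            _ ≤ _ := Nat.mul_le_mul_right _ hr
        unfold Nonblank
        rw [Nat.add_sub_cancel, add_comm (_ * _) d, Nat.add_mul_mod_self_right,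
          Nat.add_mul_div_right _ _ (width_pos a i),
          Nat.div_eq_of_lt (show d < width a i by omega),
          Nat.mod_eq_of_lt (show d < width a i by omega), zero_add]
        exact ⟨fun h => h.2.2, fun h => ⟨by omega, by omega, h⟩⟩
      have h3 := h.entry (c := r + 1 + 1) (d := d + 1) (Finset.mem_Icc.2 ⟨by omega, hr⟩)
        (Finset.mem_Icc.2 ⟨by omega, hd⟩)
      rw [← add_assoc, Nat.count_succ, Finset.sum_Icc_succ_top (show 1 ≤ d + 1 by omega)]
      push_cast
      rw [h1, if_congr h2 rfl rfl]
      split_ifs with h4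
      · rw [h4]; ring
      · rw [h3.resolve_left h4]; ring

open Classical in
theorem count_nonblank_sections (h : Admissible a k F i) {r : ℕ} (hr : r ≤ numPages a k i) :
    Nat.count (Nonblank a k F i) (r * width a i + 1) = pageLevels a i r := by
  cases r with
  | zero => simp [Nat.count_succ, Nonblank, pageLevels]
  | succ r =>
    have h1 := h.count_nonblank hr (le_refl (width a i))
    rw [h.row_sum (Finset.mem_Icc.2 ⟨by omega, hr⟩)] at h1
    have h2 := sum_width_sub_blankCount a i (r + 1)
    rw [Finset.sum_Icc_succ_top (by omega)] at h2
    rw [show (r + 1) * width a i + 1 = r * width a i + width a i + 1 by ring]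
    zify
    linarith

open Classical in
/-- The inflated last coordinate is the nonblank level of the prescribed number. -/
theorem inflate_apply_self (h : Admissible a k F i) {z : Pt}
    (hz : z ∈ levelsUpTo a i (pageLevels a i (numPages a k i))) :
    Nonblank a k F i (inflate a k F i z i) ∧
      Nat.count (Nonblank a k F i) (inflate a k F i z i) + 1 = z i := by
  have h1 := hz.1.2.1
  have h2 : z i - 1 < Nat.count (Nonblank a k F i) (numPages a k i * width a i + 1) := by
    rw [h.count_nonblank_sections le_rfl]
    have := hz.2
    omega
  obtain ⟨m, -, hm, hm'⟩ := exists_count_eq_of_lt_count _ h2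
  have h3 : inflate a k F i z i = m := by
    simp only [inflate, Function.update_self]
    rw [← hm', Nat.nth_count hm]
  rw [h3]
  exact ⟨hm, by omega⟩

/-- Inflation preserves rank among nonblank levels, and exactly `pageLevels a i r` of them lie in
the first `r` sections. This ties pages to sections. -/
theorem inflate_le_iff (h : Admissible a k F i) {z : Pt}
    (hz : z ∈ levelsUpTo a i (pageLevels a i (numPages a k i))) {r : ℕ}
    (hr : r ≤ numPages a k i) :
    inflate a k F i z i ≤ r * width a i ↔ z i ≤ pageLevels a i r := by
  classical
  obtain ⟨h1, h2⟩ := h.inflate_apply_self hz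
  rw [← h.count_nonblank_sections hr, ← h2]
  constructor
  · intro h3
    have := Nat.count_monotone (Nonblank a k F i) (show inflate a k F i z i + 1 ≤ _ from
      Nat.succ_le_succ h3)
    rwa [Nat.count_succ, if_pos h1] at this
  · intro h3
    by_contra h4
    have := Nat.count_monotone (Nonblank a k F i)
      (show r * width a i + 1 ≤ inflate a k F i z i by omega)
    omega

/-- Every nonblank level of the first `r` sections is the inflation of one of the first
`pageLevels a i r` levels. -/
theorem exists_inflate_eq (h : Admissible a k F i) {y : Pt} (hy : y ∈ Y a i)
    (hb : Nonblank a k F i (y i)) {r : ℕ} (hr : r ≤ numPages a k i)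
    (hyr : y i ≤ r * width a i) :
    ∃ z ∈ levelsUpTo a i (pageLevels a i r), inflate a k F i z = y := by
  classical
  refine ⟨Function.update y i (Nat.count (Nonblank a k F i) (y i) + 1), ⟨⟨?_, ?_, ?_⟩, ?_⟩, ?_⟩
  · intro q hq hq'
    rw [Function.update_of_ne hq'.ne]
    exact hy.1 q hq hq'
  · simp
  · intro q hq
    have := h.two_le
    rw [Function.update_of_ne (by omega)]
    exact hy.2.2 q hq
  · have := Nat.count_monotone (Nonblank a k F i) (show y i + 1 ≤ r * width a i + 1 by omega)
    rw [Nat.count_succ, if_pos hb, h.count_nonblank_sections hr] at this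
    simpa using this
  · simp [inflate, Nat.nth_count hb]

theorem inflate_mem_Y (h : Admissible a k F i) {z : Pt}
    (hz : z ∈ levelsUpTo a i (pageLevels a i (numPages a k i))) : inflate a k F i z ∈ Y a i := by
  have h1 := (h.inflate_apply_self hz).1.1
  have h2 := h.two_le
  refine ⟨fun q hq hq' => ?_, h1, fun q hq => ?_⟩
  · rw [inflate, Function.update_of_ne hq'.ne]
    exact hz.1.1 q hq hq'
  · rw [inflate, Function.update_of_ne (by omega)]
    exact hz.1.2.2 q hq

theorem inflate_injOn (h : Admissible a k F i) :
    Set.InjOn (inflate a k F i) (levelsUpTo a i (pageLevels a i (numPages a k i))) := by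
  classical
  intro y hy z hz hyz
  have h1 := h.inflate_apply_self hy
  have h2 := h.inflate_apply_self hz
  rw [hyz] at h1
  funext q
  by_cases hq : q = i
  · subst hq; omega
  · simpa [inflate, hq] using congrFun hyz q

end Admissible

/-! ### Column numbers of the nonblank levels -/

theorem section_decomposition {w m : ℕ} (hw : 0 < w) (hm : 1 ≤ m) :
    m = (m - 1) / w * w + ((m - 1) % w + 1) ∧ (m - 1) % w + 1 ≤ w := by
  have h1 := Nat.div_add_mod' (m - 1) w
  have h2 := Nat.mod_lt (m - 1) hw
  omega

theorem section_le_iff {w m r : ℕ} (hw : 0 < w) (hm : 1 ≤ m) :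
    (m - 1) / w + 1 ≤ r ↔ m ≤ r * w := by
  rw [Nat.succ_le_iff, Nat.div_lt_iff_lt_mul hw]
  omega

namespace Admissible

variable {a : ℕ → ℕ} {k : ℕ} {F : ℕ → ℕ → ℕ → ℤ} {i : ℕ}

theorem card_zeros_add_sum (h : Admissible a k F i) {c t : ℕ}
    (hc : c ∈ Finset.Icc 1 (numPages a k i)) (ht : t ≤ width a i) :
    (((Finset.Icc 1 t).filter fun d => F i c d = 0).card : ℤ) + ∑ j ∈ Finset.Icc 1 t, F i c j
      = t := by
  rw [Finset.card_filter]
  push_cast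
  rw [← Finset.sum_add_distrib]
  have : ∀ d ∈ Finset.Icc 1 t, (if F i c d = 0 then (1 : ℤ) else 0) + F i c d = 1 := by
    intro d hd
    have hd := Finset.mem_Icc.1 hd
    rcases h.entry hc (Finset.mem_Icc.2 ⟨hd.1, hd.2.trans ht⟩) with h1 | h1 <;> simp [h1]
  rw [Finset.sum_congr rfl this]
  simp

/-- At a column holding a zero the number of zeros so far solves the defining equation of `zeroCol`.
An earlier column has strictly fewer zeros, hence cannot solve it. -/
theorem zeroCol_card (h : Admissible a k F i) {c d : ℕ} (hc : c ∈ Finset.Icc 1 (numPages a k i))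
    (hd : d ∈ Finset.Icc 1 (width a i)) (h0 : F i c d = 0) :
    zeroCol F i c ((Finset.Icc 1 d).filter fun d => F i c d = 0).card = d := by
  have hd' := Finset.mem_Icc.1 hd
  refine le_antisymm (Nat.sInf_le (h.card_zeros_add_sum hc hd'.2).symm) ?_
  refine le_csInf ⟨d, (h.card_zeros_add_sum hc hd'.2).symm⟩ fun t ht => ?_
  by_contra hlt
  have h1 := h.card_zeros_add_sum hc (show t ≤ width a i by omega)
  have h2 : (t : ℤ) = _ := ht
  have h3 : ((Finset.Icc 1 t).filter fun d => F i c d = 0) ⊂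
      ((Finset.Icc 1 d).filter fun d => F i c d = 0) := by
    rw [Finset.ssubset_iff_of_subset
      (Finset.filter_subset_filter _ (Finset.Icc_subset_Icc_right (by omega)))]
    exact ⟨d, by simp [h0, hd'.1], by simp; omega⟩
  have h4 := Finset.card_lt_card h3
  omega

theorem _root_.GridEmbedding.Nonblank.section_mem {m : ℕ} (hm : Nonblank a k F i m) :
    (m - 1) / width a i + 1 ∈ Finset.Icc 1 (numPages a k i) ∧
      (m - 1) % width a i + 1 ∈ Finset.Icc 1 (width a i) := by
  have hw := width_pos a i
  refine ⟨Finset.mem_Icc.2 ⟨Nat.le_add_left _ _, (section_le_iff hw hm.1).2 hm.2.1⟩,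
    Finset.mem_Icc.2 ⟨by omega, (section_decomposition hw hm.1).2⟩⟩

open Classical in
/-- Nonblank levels have density at least one half. -/
theorem level_sub_le (h : Admissible a k F i) {m n : ℕ} (hm : Nonblank a k F i m)
    (hn : Nonblank a k F i n) (hmn : m ≤ n) :
    n - m ≤ 2 * (Nat.count (Nonblank a k F i) n - Nat.count (Nonblank a k F i) m : ℤ) + 2 := by
  have hw := width_pos a i
  rcases hmn.eq_or_lt with rfl | hlt
  · simp
  obtain ⟨m1, m2⟩ := section_decomposition hw hm.1
  obtain ⟨n1, n2⟩ := section_decomposition hw hn.1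
  obtain ⟨m3, -⟩ := hm.section_mem
  obtain ⟨n3, -⟩ := hn.section_mem
  have hle : (m - 1) / width a i ≤ (n - 1) / width a i := Nat.div_le_div_right (by omega)
  set r := (m - 1) / width a i
  set s := (n - 1) / width a i
  set b := (m - 1) % width a i
  set c := (n - 1) % width a i
  -- The prefix for `m` includes level `m`, while the one for `n` stops just before level `n`.
  have cm := h.count_nonblank (r := r) (d := b + 1) (Finset.mem_Icc.1 m3).2 m2
  have cn := h.count_nonblank (r := s) (d := c) (Finset.mem_Icc.1 n3).2 (by omega)
  rw [← m1, Nat.count_succ, if_pos hm] at cm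
  rw [add_assoc, ← n1] at cn
  have pm := (abs_lt.1 (h.row_prefix m3 m2)).2
  have pn := (abs_lt.1 (h.row_prefix n3 (show c ≤ width a i by omega))).1
  have pm' := (abs_lt.1 (h.row_prefix m3 m2)).1
  have pn' := (abs_lt.1 (h.row_prefix n3 (show c ≤ width a i by omega))).2
  have bm := h.blankCount_bounds (r + 1)
  have bn := h.blankCount_bounds (s + 1)
  have hwq : (0 : ℚ) < width a i := by exact_mod_cast hw
  set w := width a i with hwdef
  set S := blankCount a i with hS
  have xm : (S (r + 1) : ℚ) / w ≤ 1 / 2 := by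
    rw [div_le_iff₀ hwq]
    have : (2 * S (r + 1) : ℚ) ≤ w := by exact_mod_cast bm.2
    linarith
  have xn : (S (s + 1) : ℚ) / w ≤ 1 / 2 := by
    rw [div_le_iff₀ hwq]
    have : (2 * S (s + 1) : ℚ) ≤ w := by exact_mod_cast bn.2
    linarith
  set A : ℤ := ∑ j ∈ Finset.Icc 1 (b + 1), F i (r + 1) j
  set B : ℤ := ∑ j ∈ Finset.Icc 1 c, F i (s + 1) j
  set Cm := Nat.count (Nonblank a k F i) m
  set Cn := Nat.count (Nonblank a k F i) n
  -- the sections strictly between those of the two levels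
  have hmid : ∀ t, (w : ℤ) * t ≤ 2 * (∑ c ∈ Finset.Icc 1 (r + 1 + t), ((w : ℤ) - S c) -
      ∑ c ∈ Finset.Icc 1 (r + 1), ((w : ℤ) - S c)) := by
    intro t
    induction t with
    | zero => simp
    | succ t ih =>
      have := (h.blankCount_bounds (r + 1 + t + 1)).2
      rw [← add_assoc, Finset.sum_Icc_succ_top (Nat.le_add_left _ _)]
      push_cast
      linarith
  -- Each of the two row prefixes has discrepancy below `1`, giving `4` after doubling; level `n`
  -- adds `1`, and level `m`, which counts towards `Cn` but not `Cm`, takes off `2`. In integers, `<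
  -- 3` then becomes `≤ 2`.
  have key : ((n : ℚ) - m) < 2 * ((Cn : ℚ) - Cm) + 3 := by
    rcases hle.eq_or_lt with hrs | hrs
    · rw [← hrs] at cn pn xn n1
      have e1 : (n : ℚ) = r * w + (c + 1) := by exact_mod_cast n1
      have e2 : (m : ℚ) = r * w + (b + 1) := by exact_mod_cast m1
      have e3 : (b : ℚ) + 1 ≤ c := by
        have : b + 1 ≤ c := by omega
        exact_mod_cast this
      have e4 : (Cn : ℚ) - (Cm + 1) = c - B - (b + 1 - A) := by
        have : (Cn : ℤ) - (Cm + 1) = c - B - (b + 1 - A) := by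
          push_cast at cm; linarith
        exact_mod_cast this
      push_cast at pm pn
      have e5 : ((c : ℚ) - (b + 1)) * (S (r + 1) / w) ≤ (c - (b + 1)) * (1 / 2) :=
        mul_le_mul_of_nonneg_left xm (by linarith)
      linarith
    · obtain ⟨t, ht⟩ := Nat.exists_eq_add_of_le (show r + 1 ≤ s from hrs)
      have e0 := hmid t
      rw [← ht, Finset.sum_Icc_succ_top (Nat.le_add_left _ _)] at e0
      have e0' : (w : ℤ) * t + 2 * (∑ c ∈ Finset.Icc 1 r, ((w : ℤ) - S c))
          + 2 * (w - S (r + 1)) ≤ 2 * ∑ c ∈ Finset.Icc 1 s, ((w : ℤ) - S c) := by linarith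
      have e1 : (n : ℚ) = (r + 1 + t) * w + (c + 1) := by rw [ht] at n1; exact_mod_cast n1
      have e2 : (m : ℚ) = r * w + (b + 1) := by exact_mod_cast m1
      have e3 : (b : ℚ) + 1 ≤ w := by exact_mod_cast m2
      have e4 : (w : ℚ) * t + 2 * (w - S (r + 1)) ≤
          2 * ((Cn : ℚ) - c + B - (Cm + 1 - (b + 1) + A)) := by
        have : (w : ℤ) * t + 2 * (w - S (r + 1)) ≤
            2 * ((Cn : ℤ) - c + B - (Cm + 1 - (b + 1) + A)) := by
          push_cast at cm; linarith
        exact_mod_cast this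
      push_cast at pm pn
      have e5 : ((w : ℚ) - (b + 1)) * (S (r + 1) / w) ≤ (w - (b + 1)) * (1 / 2) :=
        mul_le_mul_of_nonneg_left xm (by linarith)
      have e6 : (w : ℚ) * (S (r + 1) / w) = S (r + 1) := mul_div_cancel₀ _ hwq.ne'
      have e7 : (c : ℚ) * (S (s + 1) / w) ≤ c * (1 / 2) :=
        mul_le_mul_of_nonneg_left xn (Nat.cast_nonneg _)
      linarith
  have key' : ((n : ℤ) - m) < 2 * ((Cn : ℤ) - Cm) + 3 := by exact_mod_cast key
  omega

end Admissible

/-! ### Stacks -/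

/-- The image of the grid under `I_i ∘ f_i`. -/
def inflatedImage (a : ℕ → ℕ) (k : ℕ) (F : ℕ → ℕ → ℕ → ℤ) (i : ℕ) : Set Pt :=
  (inflate a k F i ∘ fMap a k F i) '' grid a k

/-- The point of the `c`-th section of `Y_i` that reduces to the point `x` of `⟨Y_i⟩`. -/
def cell (a : ℕ → ℕ) (i : ℕ) (x : Pt) (c : ℕ) : Pt :=
  Function.update x i ((c - 1) * width a i + x i)

/-- The sections that contribute a point to the stack over `x`. -/
def Occupied (a : ℕ → ℕ) (k : ℕ) (F : ℕ → ℕ → ℕ → ℤ) (i : ℕ) (x : Pt) (c : ℕ) : Prop :=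
  1 ≤ c ∧ c ≤ numPages a k i ∧ cell a i x c ∈ inflatedImage a k F i

/-- `⌈r · a 1 ⋯ a i / 2 ^ e_i⌉`, the maximum height of the stacks formed by `r` sections. -/
noncomputable def stackLevels (a : ℕ → ℕ) (i r : ℕ) : ℕ :=
  ⌈((r * vol a i : ℕ) : ℚ) / 2 ^ expo a i⌉₊

theorem stackLevels_le_iff {a : ℕ → ℕ} {i r m : ℕ} :
    stackLevels a i r ≤ m ↔ r * vol a i ≤ m * 2 ^ expo a i := ceil_div_two_pow_le

/-- The height of the stacks formed by all sections of `r` many `(i + 1)`-pages is the number of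
levels those pages need at the next stage. -/
theorem stackLevels_mul_side (a : ℕ → ℕ) (i r : ℕ) :
    stackLevels a i (r * a (i + 1)) = pageLevels a (i + 1) r := by
  unfold stackLevels pageLevels
  rw [vol_succ, Nat.add_sub_cancel, show r * a (i + 1) * vol a i = r * (vol a i * a (i + 1)) by ring]

theorem mem_secsG {a : ℕ → ℕ} {k : ℕ} {F : ℕ → ℕ → ℕ → ℤ} {i r : ℕ} {y : Pt} :
    y ∈ secsG a k F i r ↔ y ∈ Y a i ∧ Nonblank a k F i (y i) ∧ y i ≤ r * width a i := by
  simp only [secsG, secG, sec, Set.mem_iUnion, Set.mem_Icc, Set.mem_ofPred_eq, exists_prop]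
  constructor
  · rintro ⟨j, ⟨-, hj⟩, ⟨hy, -, h1⟩, h2⟩
    exact ⟨hy, h2, h1.trans (Nat.mul_le_mul_right _ hj)⟩
  · rintro ⟨hy, h1, h2⟩
    have h3 := section_decomposition (width_pos a i) h1.1
    refine ⟨(y i - 1) / width a i + 1, ⟨Nat.le_add_left _ _,
      (section_le_iff (width_pos a i) h1.1).2 h2⟩, ⟨hy, ?_, ?_⟩, h1⟩
    · rw [Nat.add_sub_cancel]
      omega
    · rw [add_mul, one_mul]
      omega

theorem section_eq_of_mem_sec {a : ℕ → ℕ} {i j : ℕ} {y : Pt} (hj : 1 ≤ j) (hy : y ∈ sec a i j) :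
    (y i - 1) / width a i + 1 = j := by
  obtain ⟨j, rfl⟩ : ∃ t, j = t + 1 := ⟨j - 1, by omega⟩
  obtain ⟨-, h1, h2⟩ := hy
  rw [Nat.add_sub_cancel] at h1
  have : (y i - 1) / width a i = j := Nat.div_eq_of_lt_le (by omega) (by omega)
  rw [this]

theorem cell_apply_self (a : ℕ → ℕ) (i : ℕ) (x : Pt) (c : ℕ) :
    cell a i x c i = (c - 1) * width a i + x i := by simp [cell]

theorem cell_apply_of_ne (a : ℕ → ℕ) {i q : ℕ} (h : q ≠ i) (x : Pt) (c : ℕ) :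
    cell a i x c q = x q := by simp [cell, h]

theorem cell_section {a : ℕ → ℕ} {i c : ℕ} {x : Pt} (hi : 1 ≤ i) (hx : x ∈ bracketY a i)
    (hc : 1 ≤ c) :
    (cell a i x c i - 1) / width a i + 1 = c ∧ (cell a i x c i - 1) % width a i + 1 = x i := by
  have h1 := hx.1 i hi le_rfl
  obtain ⟨c, rfl⟩ : ∃ t, c = t + 1 := ⟨c - 1, by omega⟩
  rw [cell_apply_self, Nat.add_sub_cancel,
    show c * width a i + x i - 1 = (x i - 1) + c * width a i by omega,
    Nat.add_mul_mod_self_right, Nat.add_mul_div_right _ _ (width_pos a i),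
    Nat.div_eq_of_lt (by omega), Nat.mod_eq_of_lt (by omega)]
  omega

theorem cell_injOn {a : ℕ → ℕ} {i : ℕ} {x : Pt} (hi : 1 ≤ i) (hx : x ∈ bracketY a i) :
    Set.InjOn (cell a i x) {c | 1 ≤ c} := by
  intro c hc d hd hcd
  rw [← (cell_section hi hx hc).1, ← (cell_section hi hx hd).1, hcd]

theorem cell_mem_Y {a : ℕ → ℕ} {i : ℕ} {x : Pt} (hi : 1 ≤ i) (hx : x ∈ bracketY a i) (c : ℕ) :
    cell a i x c ∈ Y a i := by
  refine ⟨fun q hq hq' => ?_, ?_, fun q hq => ?_⟩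
  · rw [cell_apply_of_ne a hq'.ne]
    exact hx.1 q hq hq'.le
  · have := hx.1 i hi le_rfl
    rw [cell_apply_self]
    omega
  · rw [cell_apply_of_ne a (by omega)]
    exact hx.2 q hq

theorem exists_eq_cell {a : ℕ → ℕ} {i : ℕ} {y : Pt} (hi : 1 ≤ i) (hy : y ∈ Y a i) :
    ∃ x ∈ bracketY a i, y = cell a i x ((y i - 1) / width a i + 1) := by
  have h1 := section_decomposition (width_pos a i) hy.2.1
  refine ⟨Function.update y i ((y i - 1) % width a i + 1), ⟨fun q hq hq' => ?_, fun q hq => ?_⟩,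
    ?_⟩
  · by_cases h : q = i
    · subst h
      rw [Function.update_self]
      exact ⟨Nat.le_add_left _ _, h1.2⟩
    · rw [Function.update_of_ne h]
      exact hy.1 q hq (by omega)
  · rw [Function.update_of_ne (by omega)]
    exact hy.2.2 q hq
  · rw [cell, Function.update_idem, Function.update_self, Nat.add_sub_cancel, ← h1.1,
      Function.update_eq_self]

theorem eq_of_update_succ_eq {a : ℕ → ℕ} {i n m : ℕ} {x y : Pt} (hx : x ∈ bracketY a i)
    (hy : y ∈ bracketY a i)
    (h : Function.update x (i + 1) n = Function.update y (i + 1) m) : x = y ∧ n = m := by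
  have := update_succ_injOn_box i (width a) Set.univ (show (x, n) ∈ _ from ⟨hx, trivial⟩)
    (show (y, m) ∈ _ from ⟨hy, trivial⟩) h
  exact Prod.mk.inj this

theorem bracketY_nonempty (a : ℕ → ℕ) (i : ℕ) : (bracketY a i).Nonempty := by
  refine ⟨fun q => if 1 ≤ q ∧ q ≤ i then 1 else 0, fun q hq hq' => ?_, fun q hq => ?_⟩
  · simp only [hq, hq', and_self, if_true]
    exact ⟨le_rfl, width_pos a q⟩
  · exact if_neg (by omega)

theorem proj_update_succ {a : ℕ → ℕ} {i : ℕ} {x : Pt} (hx : x ∈ bracketY a i) (n : ℕ) :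
    proj i (Function.update x (i + 1) n) = x := by
  funext q
  unfold proj
  split_ifs with h
  · rw [Function.update_of_ne (by omega)]
  · exact (hx.2 q (by omega)).symm

theorem fMap_succ (a : ℕ → ℕ) (k : ℕ) (F : ℕ → ℕ → ℕ → ℤ) {i : ℕ} (hi : 2 ≤ i) :
    fMap a k F (i + 1) = sigma a k F i ∘ inflate a k F i ∘ fMap a k F i := by
  obtain ⟨j, rfl⟩ : ∃ j, i = j + 2 := ⟨i - 2, by omega⟩
  rfl

/-! ### Inflated images, occupied sections and stack heights -/

namespace Admissible

variable {a : ℕ → ℕ} {k : ℕ} {F : ℕ → ℕ → ℕ → ℤ} {i : ℕ}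

theorem fMap_mem_levelsUpTo (h : Admissible a k F i) (hf : FillsPages a k i (fMap a k F i)) {x : Pt}
    (hx : x ∈ grid a k) :
    fMap a k F i x ∈ levelsUpTo a i (pageLevels a i (numPages a k i)) :=
  hf.mem x hx _ (pageIndex_le_numPages hx (by have := h.lt; omega))

theorem inflate_fMap_mem (h : Admissible a k F i) (hf : FillsPages a k i (fMap a k F i)) {x : Pt}
    (hx : x ∈ grid a k) {r : ℕ} (hr : r ≤ numPages a k i) (hxr : pageIndex a k i x ≤ r) :
    inflate a k F i (fMap a k F i x) ∈ secsG a k F i r := by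
  have h1 := h.fMap_mem_levelsUpTo hf hx
  exact mem_secsG.2 ⟨h.inflate_mem_Y h1, (h.inflate_apply_self h1).1,
    (h.inflate_le_iff h1 hr).2 (hf.mem x hx r hxr).2⟩

theorem inflatedImage_subset (h : Admissible a k F i) (hf : FillsPages a k i (fMap a k F i)) :
    inflatedImage a k F i ⊆ secsG a k F i (numPages a k i) := by
  rintro _ ⟨x, hx, rfl⟩
  exact h.inflate_fMap_mem hf hx le_rfl (pageIndex_le_numPages hx (by have := h.lt; omega))

/-- The levels that inflate into the first `r` sections are covered by `r + 1` pages. The spare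
level in the invariant is not needed here, only for the strict inclusion in `secsG_ssubset`. -/
theorem exists_inflate_fMap_eq (h : Admissible a k F i) (hf : FillsPages a k i (fMap a k F i))
    {r : ℕ} (hr : 1 ≤ r) (hr' : r + 1 ≤ numPages a k i) {y : Pt} (hy : y ∈ secsG a k F i r) :
    ∃ x ∈ grid a k, pageIndex a k i x ≤ r + 1 ∧ inflate a k F i (fMap a k F i x) = y := by
  obtain ⟨h1, h2, h3⟩ := mem_secsG.1 hy
  obtain ⟨z, hz, rfl⟩ := h.exists_inflate_eq h1 h2 (by omega) h3
  obtain ⟨x, hx, hxr, rfl⟩ := hf.exists_eq r hr hr' z ⟨hz.1, hz.2.trans (Nat.le_succ _)⟩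
  exact ⟨x, hx, hxr, rfl⟩

theorem nonblank_cell_iff (h : Admissible a k F i) {x : Pt} (hx : x ∈ bracketY a i) {c : ℕ}
    (hc : 1 ≤ c) (hc' : c ≤ numPages a k i) :
    Nonblank a k F i (cell a i x c i) ↔ F i c (x i) = 0 := by
  have hi : 1 ≤ i := by have := h.two_le; omega
  have h1 := cell_section hi hx hc
  have h2 := (cell_mem_Y hi hx c).2.1
  unfold Nonblank
  rw [h1.1, h1.2]
  exact ⟨fun h => h.2.2,
    fun h => ⟨h2, (section_le_iff (width_pos a i) h2).1 (by rw [h1.1]; exact hc'), h⟩⟩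

theorem entry_eq_zero_of_occupied (h : Admissible a k F i) (hf : FillsPages a k i (fMap a k F i))
    {x : Pt} (hx : x ∈ bracketY a i) {c : ℕ} (hc : Occupied a k F i x c) : F i c (x i) = 0 :=
  (h.nonblank_cell_iff hx hc.1 hc.2.1).1 (mem_secsG.1 (h.inflatedImage_subset hf hc.2.2)).2.1

/-- Sections before the last are completely filled, so only blankness can leave a gap. In the last
section just the implication `entry_eq_zero_of_occupied` is available. -/
theorem occupied_iff (h : Admissible a k F i) (hf : FillsPages a k i (fMap a k F i))
    {x : Pt} (hx : x ∈ bracketY a i) {c : ℕ} (hc : 1 ≤ c) (hc' : c < numPages a k i) :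
    Occupied a k F i x c ↔ F i c (x i) = 0 := by
  have hi : 1 ≤ i := by have := h.two_le; omega
  refine ⟨h.entry_eq_zero_of_occupied hf hx, fun h0 => ⟨hc, hc'.le, ?_⟩⟩
  have h1 := cell_mem_Y hi hx c
  have h2 : cell a i x c ∈ secsG a k F i c :=
    mem_secsG.2 ⟨h1, (h.nonblank_cell_iff hx hc hc'.le).2 h0,
      (section_le_iff (width_pos a i) h1.2.1).1 (cell_section hi hx hc).1.le⟩
  obtain ⟨z, hz, -, hz'⟩ := h.exists_inflate_fMap_eq hf hc hc' h2
  exact ⟨z, hz, hz'⟩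

open Classical in
-- The points counted by the stacking map are the cells over `x` in occupied sections up to `c`.
-- From here on $\sigma_i$ is handled through `Nat.count`.
theorem sigma_cell (h : Admissible a k F i) (hf : FillsPages a k i (fMap a k F i)) {x : Pt}
    (hx : x ∈ bracketY a i) {c : ℕ} (hc : 1 ≤ c) (hc' : c ≤ numPages a k i) :
    sigma a k F i (cell a i x c) =
      Function.update x (i + 1) (Nat.count (Occupied a k F i x) (c + 1)) := by
  have hi : 1 ≤ i := by have := h.two_le; omega
  have h1 := cell_section hi hx hc
  unfold sigma stackMap
  rw [h1.1, h1.2]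
  have h2 : Function.update (cell a i x c) i (x i) = x := by simp [cell]
  rw [h2]
  congr 1
  have h3 : {z | z ∈ secsG a k F i c ∩ (inflate a k F i ∘ fMap a k F i) '' grid a k ∧
      proj (i - 1) z = proj (i - 1) (cell a i x c) ∧ z i ≡ cell a i x c i [MOD width a i]} =
      cell a i x '' ((Finset.range (c + 1)).filter (Occupied a k F i x) : Finset ℕ) := by
    ext z
    simp only [Set.mem_ofPred_eq, Set.mem_image, Finset.coe_filter, Finset.mem_range]
    constructor
    · rintro ⟨⟨h4, h5⟩, h6, h7⟩
      obtain ⟨h8, -, h9⟩ := mem_secsG.1 h4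
      obtain ⟨w, hw, hzw⟩ := exists_eq_cell hi h8
      have h10 := (section_le_iff (width_pos a i) h8.2.1).2 h9
      have hwx : w = x := by
        have hwi : w i = x i := by
          have e1 := (cell_section hi hw (Nat.le_add_left 1 ((z i - 1) / width a i))).2
          rw [← hzw] at e1
          rw [← e1, ← h1.2]
          have : z i - 1 ≡ cell a i x c i - 1 [MOD width a i] := by
            refine Nat.ModEq.add_right_cancel' 1 ?_
            rw [Nat.sub_add_cancel h8.2.1, Nat.sub_add_cancel (cell_mem_Y hi hx c).2.1]
            exact h7
          rw [this]
        funext q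
        by_cases hq : q = i
        · rw [hq, hwi]
        by_cases hq' : 1 ≤ q ∧ q < i
        · have e1 := congrFun h6 q
          rw [hzw] at e1
          simpa [proj, show 1 ≤ q ∧ q ≤ i - 1 by omega, cell, hq] using e1
        · rw [hw.2 q (by omega), hx.2 q (by omega)]
      rw [hwx] at hzw
      exact ⟨_, ⟨by omega, Nat.le_add_left _ _, h10.trans hc', hzw ▸ h5⟩, hzw.symm⟩
    · rintro ⟨d, ⟨hd, hd'⟩, rfl⟩
      have h4 := cell_mem_Y hi hx d
      refine ⟨⟨mem_secsG.2 ⟨h4, (h.nonblank_cell_iff hx hd'.1 hd'.2.1).2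
        (h.entry_eq_zero_of_occupied hf hx hd'), (section_le_iff (width_pos a i) h4.2.1).1 ?_⟩,
        hd'.2.2⟩, ?_, ?_⟩
      · rw [(cell_section hi hx hd'.1).1]
        omega
      · funext q
        unfold proj
        split_ifs with hq
        · rw [cell_apply_of_ne a (by omega), cell_apply_of_ne a (by omega)]
        · rfl
      · rw [cell_apply_self, cell_apply_self]
        refine Nat.ModEq.add_right _ ?_
        rw [Nat.ModEq, Nat.mul_mod_left, Nat.mul_mod_left]
  rw [h3, Set.InjOn.ncard_image, Set.ncard_coe_finset, Nat.count_eq_card_filter_range]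
  exact (cell_injOn hi hx).mono fun d hd => by
    simp only [Finset.coe_filter] at hd
    exact hd.2.1

open Classical in
theorem count_occupied_injective {x : Pt} {c d : ℕ} (hc : Occupied a k F i x c)
    (hd : Occupied a k F i x d)
    (h : Nat.count (Occupied a k F i x) (c + 1) = Nat.count (Occupied a k F i x) (d + 1)) :
    c = d := by
  rw [Nat.count_succ, Nat.count_succ, if_pos hc, if_pos hd] at h
  exact Nat.count_injective hc hd (Nat.succ.inj h)

theorem exists_eq_occupied_cell (h : Admissible a k F i) (hf : FillsPages a k i (fMap a k F i))
    {y : Pt} (hy : y ∈ inflatedImage a k F i) :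
    ∃ x ∈ bracketY a i, y = cell a i x ((y i - 1) / width a i + 1) ∧
      Occupied a k F i x ((y i - 1) / width a i + 1) := by
  have hi : 1 ≤ i := by have := h.two_le; omega
  have h1 := mem_secsG.1 (h.inflatedImage_subset hf hy)
  obtain ⟨x, hx, hyx⟩ := exists_eq_cell hi h1.1
  exact ⟨x, hx, hyx, Nat.le_add_left _ _, (section_le_iff (width_pos a i) h1.1.2.1).2 h1.2.2,
    hyx ▸ hy⟩

open Classical in
/-- The stack over `x` has one point for each occupied section. -/
theorem Stack_eq_image (h : Admissible a k F i) (hf : FillsPages a k i (fMap a k F i)) {x : Pt}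
    (hx : x ∈ bracketY a i) (r : ℕ) :
    Stack a k F (i + 1) x r =
      (fun c => Function.update x (i + 1) (Nat.count (Occupied a k F i x) (c + 1))) ''
        ((Finset.range (r + 1)).filter (Occupied a k F i x) : Finset ℕ) := by
  have hi : 1 ≤ i := by have := h.two_le; omega
  ext w
  simp only [Stack, Nat.add_sub_cancel, Set.mem_ofPred_eq, Set.mem_image, Finset.coe_filter,
    Finset.mem_range]
  constructor
  · rintro ⟨y, ⟨hy, hy'⟩, hw, hp⟩
    obtain ⟨z, hz, hyz, hocc⟩ := h.exists_eq_occupied_cell hf hy'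
    rw [hyz, h.sigma_cell hf hz hocc.1 hocc.2.1] at hw
    rw [hw, proj_update_succ hz] at hp
    subst hp
    obtain ⟨h1, -, h2⟩ := mem_secsG.1 hy
    exact ⟨_, ⟨Nat.lt_succ_of_le ((section_le_iff (width_pos a i) h1.2.1).2 h2), hocc⟩, hw.symm⟩
  · rintro ⟨c, ⟨hc, hocc⟩, rfl⟩
    refine ⟨cell a i x c, ⟨?_, hocc.2.2⟩, (h.sigma_cell hf hx hocc.1 hocc.2.1).symm,
      proj_update_succ hx _⟩
    have h1 := mem_secsG.1 (h.inflatedImage_subset hf hocc.2.2)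
    refine mem_secsG.2 ⟨h1.1, h1.2.1, (section_le_iff (width_pos a i) h1.1.2.1).1 ?_⟩
    rw [(cell_section hi hx hocc.1).1]
    omega

open Classical in
theorem ncard_Stack (h : Admissible a k F i) (hf : FillsPages a k i (fMap a k F i)) {x : Pt}
    (hx : x ∈ bracketY a i) (r : ℕ) :
    (Stack a k F (i + 1) x r).ncard = Nat.count (Occupied a k F i x) (r + 1) := by
  rw [h.Stack_eq_image hf hx r, Set.InjOn.ncard_image, Set.ncard_coe_finset,
    Nat.count_eq_card_filter_range]
  intro c hc d hd hcd
  simp only [Finset.coe_filter] at hc hd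
  exact count_occupied_injective hc.2 hd.2 (eq_of_update_succ_eq hx hx hcd).2

open Classical in
theorem count_occupied_le (h : Admissible a k F i) (hf : FillsPages a k i (fMap a k F i)) {x : Pt}
    (hx : x ∈ bracketY a i) {r : ℕ} (hr : r ≤ numPages a k i) :
    (Nat.count (Occupied a k F i x) (r + 1) : ℤ) + ∑ c ∈ Finset.Icc 1 r, F i c (x i) ≤ r := by
  have hi : 1 ≤ i := by have := h.two_le; omega
  induction r with
  | zero => simp [Nat.count_succ, Occupied]
  | succ r ih =>
    have h1 := ih (by omega)
    have h2 := h.entry (Finset.mem_Icc.2 ⟨Nat.le_add_left 1 r, hr⟩)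
      (Finset.mem_Icc.2 (hx.1 i hi le_rfl))
    rw [Nat.count_succ, Finset.sum_Icc_succ_top (by omega)]
    split_ifs with h3
    · rw [h.entry_eq_zero_of_occupied hf hx h3]
      push_cast
      linarith
    · push_cast
      omega

open Classical in
theorem count_occupied_eq (h : Admissible a k F i) (hf : FillsPages a k i (fMap a k F i)) {x : Pt}
    (hx : x ∈ bracketY a i) {r : ℕ} (hr : r < numPages a k i) :
    (Nat.count (Occupied a k F i x) (r + 1) : ℤ) + ∑ c ∈ Finset.Icc 1 r, F i c (x i) = r := by
  have hi : 1 ≤ i := by have := h.two_le; omega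
  induction r with
  | zero => simp [Nat.count_succ, Occupied]
  | succ r ih =>
    have h1 := ih (by omega)
    have h2 := h.entry (Finset.mem_Icc.2 ⟨Nat.le_add_left 1 r, hr.le⟩)
      (Finset.mem_Icc.2 (hx.1 i hi le_rfl))
    rw [Nat.count_succ, Finset.sum_Icc_succ_top (by omega),
      if_congr (h.occupied_iff hf hx (Nat.le_add_left 1 r) hr) rfl rfl]
    split_ifs with h3
    · rw [h3]
      push_cast
      linarith
    · rw [h2.resolve_left h3]
      push_cast
      linarith

/-- Let $Z$ be the column sum and $S$ the sum of the $s_i(c)$. The discrepancy bound gives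
$|S-wZ|<w$, and $rw-S$ is the number of nonblank levels, which lies between $w(H-1)$ and $wH$ for
$H$ = `stackLevels a i r`. Dividing by $w$ leaves $H-1$ and $H$ for the number $r-Z$ of zeros. -/
theorem column_sum_bounds (h : Admissible a k F i) {d : ℕ} (hd : d ∈ Finset.Icc 1 (width a i))
    {r : ℕ} (hr : r ≤ numPages a k i) :
    (r : ℤ) - ∑ c ∈ Finset.Icc 1 r, F i c d ≤ stackLevels a i r ∧
      (stackLevels a i r : ℤ) ≤ (r : ℤ) - ∑ c ∈ Finset.Icc 1 r, F i c d + 1 := by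
  have hw : (0 : ℚ) < width a i := by exact_mod_cast width_pos a i
  have hw' : (0 : ℤ) < width a i := by exact_mod_cast width_pos a i
  have h1 := h.col_prefix hd hr
  have h2 := sum_width_sub_blankCount a i r
  rw [Finset.sum_sub_distrib] at h2
  simp only [Finset.sum_const, Nat.card_Icc, Nat.add_sub_cancel, nsmul_eq_mul] at h2
  set Z := ∑ c ∈ Finset.Icc 1 r, F i c d
  set S := ∑ c ∈ Finset.Icc 1 r, blankCount a i c
  have h3 : |S - width a i * Z| < (width a i : ℤ) := by
    have e : (S : ℚ) / width a i - Z = (S - width a i * Z) / width a i := by field_simp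
    rw [e, abs_div, abs_of_pos hw, div_lt_one hw] at h1
    exact_mod_cast h1
  obtain ⟨h4, h5⟩ := abs_lt.1 h3
  have e := h.expo_mul_width
  have h6 : pageLevels a i r ≤ stackLevels a i r * width a i := by
    rw [pageLevels_le_iff, mul_assoc, mul_comm (width a i), e]
    exact stackLevels_le_iff.1 le_rfl
  zify at h6
  refine ⟨?_, ?_⟩
  · have h7 : (width a i : ℤ) * (r - Z) < width a i * (stackLevels a i r + 1) := by
      linarith
    have := lt_of_mul_lt_mul_left h7 hw'.le
    omega
  · have h8 : ((stackLevels a i r : ℤ) - 1) * width a i ≤ pageLevels a i r := by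
      by_contra h9
      have h10 : pageLevels a i r ≤ (stackLevels a i r - 1) * width a i := by
        rcases Nat.eq_zero_or_pos (stackLevels a i r) with h0 | h0
        · rw [h0] at h9
          push_cast at h9
          have := Int.natCast_nonneg (pageLevels a i r)
          linarith
        · zify [h0]
          linarith
      rw [pageLevels_le_iff, mul_assoc, mul_comm (width a i), e, ← stackLevels_le_iff] at h10
      have h11 : stackLevels a i r = 0 := by omega
      rw [h11] at h9
      have := Int.natCast_nonneg (pageLevels a i r)
      push_cast at h9
      linarith
    have h7 : (width a i : ℤ) * (stackLevels a i r - 2) < width a i * (r - Z) := by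
      linarith
    have := lt_of_mul_lt_mul_left h7 hw'.le
    omega

open Classical in
theorem count_occupied_le_stackLevels (h : Admissible a k F i)
    (hf : FillsPages a k i (fMap a k F i)) {x : Pt} (hx : x ∈ bracketY a i) {r : ℕ}
    (hr : r ≤ numPages a k i) :
    Nat.count (Occupied a k F i x) (r + 1) ≤ stackLevels a i r := by
  have hi : 1 ≤ i := by have := h.two_le; omega
  have h1 := h.count_occupied_le hf hx hr
  have h2 := (h.column_sum_bounds (Finset.mem_Icc.2 (hx.1 i hi le_rfl)) hr).1
  omega

open Classical in
theorem stackLevels_le_count_occupied (h : Admissible a k F i)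
    (hf : FillsPages a k i (fMap a k F i)) {x : Pt} (hx : x ∈ bracketY a i) {r : ℕ}
    (hr : r < numPages a k i) :
    stackLevels a i r ≤ Nat.count (Occupied a k F i x) (r + 1) + 1 := by
  have hi : 1 ≤ i := by have := h.two_le; omega
  have h1 := h.count_occupied_eq hf hx hr
  have h2 := (h.column_sum_bounds (Finset.mem_Icc.2 (hx.1 i hi le_rfl)) hr.le).2
  omega

open Classical in
/-- The value `f_{i+1}(x)`, in terms of the section that contains the inflated point. -/
theorem fMap_succ_eq (h : Admissible a k F i) (hf : FillsPages a k i (fMap a k F i)) {x : Pt}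
    (hx : x ∈ grid a k) :
    ∃ z ∈ bracketY a i, ∃ c, Occupied a k F i z c ∧
      inflate a k F i (fMap a k F i x) = cell a i z c ∧
      fMap a k F (i + 1) x =
        Function.update z (i + 1) (Nat.count (Occupied a k F i z) (c + 1)) ∧
      ∀ r, r ≤ numPages a k i → pageIndex a k i x ≤ r → c ≤ r := by
  have hA : inflate a k F i (fMap a k F i x) ∈ inflatedImage a k F i := ⟨x, hx, rfl⟩
  obtain ⟨z, hz, hyz, hocc⟩ := h.exists_eq_occupied_cell hf hA
  refine ⟨z, hz, _, hocc, hyz, ?_, fun r hr hxr => ?_⟩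
  · rw [fMap_succ a k F h.two_le, Function.comp_apply, Function.comp_apply]
    conv_lhs => rw [hyz]
    exact h.sigma_cell hf hz hocc.1 hocc.2.1
  · have h1 := mem_secsG.1 (h.inflate_fMap_mem hf hx hr hxr)
    exact (section_le_iff (width_pos a i) h1.1.2.1).2 h1.2.2

/-- The points over the first `r` sections are stacked to height at most `stackLevels a i r`. -/
theorem fMap_succ_mem_levelsUpTo (h : Admissible a k F i) (hf : FillsPages a k i (fMap a k F i))
    {x : Pt} (hx : x ∈ grid a k) {r : ℕ} (hr : r ≤ numPages a k i)
    (hxr : pageIndex a k i x ≤ r) : fMap a k F (i + 1) x ∈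
      levelsUpTo a (i + 1) (stackLevels a i r) := by
  classical
  obtain ⟨z, hz, c, hocc, -, hxz, hc⟩ := h.fMap_succ_eq hf hx
  have h1 := Nat.count_monotone (Occupied a k F i z) (Nat.succ_le_succ (hc r hr hxr))
  have h2 := h.count_occupied_le_stackLevels hf hz hr
  rw [hxz]
  refine ⟨⟨fun q hq hq' => ?_, ?_, fun q hq => ?_⟩, ?_⟩
  · rw [Function.update_of_ne hq'.ne]
    exact hz.1 q hq (by omega)
  · rw [Function.update_self, Nat.count_succ, if_pos hocc]
    omega
  · rw [Function.update_of_ne (by omega)]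
    exact hz.2 q (by omega)
  · rw [Function.update_self]
    exact h1.trans h2

/-- Injectivity holds because base point and height determine the section. The upper bound is the
maximal stack height. Covering holds because even the shortest stack over slightly fewer sections
than `r + 1` pages provide exceeds the required level. -/
theorem fillsPages_succ (h : Admissible a k F i) (hf : FillsPages a k i (fMap a k F i)) :
    FillsPages a k (i + 1) (fMap a k F (i + 1)) := by
  classical
  have hP := numPages_eq_mul (a := a) h.lt
  refine ⟨?_, ?_, ?_⟩
  · intro x hx y hy hxy
    obtain ⟨z, hz, c, hoc, hxc, hxz, -⟩ := h.fMap_succ_eq hf hx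
    obtain ⟨w, hw, d, hod, hyd, hyw, -⟩ := h.fMap_succ_eq hf hy
    rw [hxz, hyw] at hxy
    obtain ⟨rfl, h1⟩ := eq_of_update_succ_eq hz hw hxy
    obtain rfl := count_occupied_injective hoc hod h1
    exact hf.injOn hx hy (h.inflate_injOn (h.fMap_mem_levelsUpTo hf hx)
      (h.fMap_mem_levelsUpTo hf hy) (hxc.trans hyd.symm))
  · intro x hx r hr
    have h1 := pageIndex_le_numPages hx h.lt
    -- The invariant allows any `r`, whereas stack bounds need at most $P_i$ sections; hence the
    -- truncation.
    have h2 : min r (numPages a k (i + 1)) * a (i + 1) ≤ numPages a k i := by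
      rw [hP, mul_comm]
      exact Nat.mul_le_mul_left _ (min_le_right _ _)
    have h3 := h.fMap_succ_mem_levelsUpTo hf hx h2
      ((pageIndex_le_mul_iff hx h.lt _).2 (le_min hr h1))
    rw [stackLevels_mul_side] at h3
    exact ⟨h3.1, h3.2.trans (pageLevels_mono (min_le_left _ _))⟩
  · intro r hr hr' y hy
    have ha : 2 ^ 22 ≤ a (i + 1) := h.le_side _ (by omega) h.lt
    norm_num at ha
    have hR : (r + 1) * a (i + 1) ≤ numPages a k i := by
      rw [hP, mul_comm]
      exact Nat.mul_le_mul_left _ hr'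
    have hRe : (r + 1) * a (i + 1) = r * a (i + 1) + a (i + 1) := by ring
    -- One section fewer than `r + 1` pages provide: section `R` is not the last, and filling the
    -- first `R` sections takes only `R + 1` of the `i`-pages.
    obtain ⟨R, hRR⟩ : ∃ R, (r + 1) * a (i + 1) = R + 1 := ⟨(r + 1) * a (i + 1) - 1, by omega⟩
    -- One of the two levels is the extra level to be covered, the other allows for stacks one short
    -- of the maximum. Failure would give `R < r * a (i + 1) + 4`, against the size of `a (i + 1)`.
    have hlev : pageLevels a (i + 1) r + 2 ≤ stackLevels a i R := by
      by_contra h0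
      have h1 : stackLevels a i R ≤ pageLevels a (i + 1) r + 1 := by omega
      rw [stackLevels_le_iff] at h1
      have h2 := pageLevels_mul_lt a (i + 1) r
      rw [Nat.add_sub_cancel, vol_succ] at h2
      have h3 := two_pow_expo_lt h.vol_pos
      have h4 : R * vol a i < (r * a (i + 1) + 4) * vol a i := by
        calc R * vol a i ≤ _ := h1
          _ = pageLevels a (i + 1) r * 2 ^ expo a i + 2 ^ expo a i := by ring
          _ < r * (vol a i * a (i + 1)) + 4 * vol a i := by omega
          _ = _ := by ring
      have h5 := Nat.lt_of_mul_lt_mul_right h4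
      omega
    obtain ⟨⟨hy1, hy2, hy3⟩, hy4⟩ := hy
    have hz : Function.update y (i + 1) 0 ∈ bracketY a i := by
      refine ⟨fun q hq hq' => ?_, fun q hq => ?_⟩
      · rw [Function.update_of_ne (by omega)]
        exact hy1 q hq (by omega)
      · by_cases hq' : q = i + 1
        · rw [hq', Function.update_self]
        · rw [Function.update_of_ne hq']
          exact hy3 q (by omega)
    set z := Function.update y (i + 1) 0 with hzdef
    have h1 := h.stackLevels_le_count_occupied hf hz (show R < numPages a k i by omega)
    obtain ⟨c, hc, hocc, hcount⟩ := exists_count_eq_of_lt_count (Occupied a k F i z)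
      (show y (i + 1) - 1 < Nat.count (Occupied a k F i z) (R + 1) by omega)
    have h2 := mem_secsG.1 (h.inflatedImage_subset hf hocc.2.2)
    have hi : 1 ≤ i := by have := h.two_le; omega
    have h3 : cell a i z c ∈ secsG a k F i R := by
      refine mem_secsG.2 ⟨h2.1, h2.2.1, (section_le_iff (width_pos a i) h2.1.2.1).1 ?_⟩
      rw [(cell_section hi hz hocc.1).1]
      omega
    obtain ⟨x, hx, hxR, hxc⟩ := h.exists_inflate_fMap_eq hf (by omega) (by omega) h3
    refine ⟨x, hx, (pageIndex_le_mul_iff hx h.lt _).1 (hRR ▸ hxR), ?_⟩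
    rw [fMap_succ a k F h.two_le, Function.comp_apply, Function.comp_apply, hxc,
      h.sigma_cell hf hz hocc.1 hocc.2.1, Nat.count_succ, if_pos hocc, hcount,
      Nat.sub_add_cancel hy2, hzdef, Function.update_idem, Function.update_eq_self]

/-- The lower bound is a pigeonhole count: the points of `r` pages are placed injectively on
$2^{e_i}$ stacks. This also covers $r=P_i$, where the last section may be incomplete. -/
theorem maxHeight_eq (h : Admissible a k F i) (hf : FillsPages a k i (fMap a k F i)) {r : ℕ}
    (hr : r ≤ numPages a k i) : maxHeight a k F (i + 1) r = stackLevels a i r := by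
  classical
  have hik := h.lt
  have hub : ∀ n ∈ (fun x => (Stack a k F (i + 1) x r).ncard) '' bracketY a (i + 1 - 1),
      n ≤ stackLevels a i r := by
    rintro _ ⟨x, hx, rfl⟩
    simp only
    rw [h.ncard_Stack hf hx r]
    exact h.count_occupied_le_stackLevels hf hx hr
  refine le_antisymm ?_ ?_
  · refine csSup_le ?_ hub
    exact (bracketY_nonempty a i).image _
  · have hsub : fMap a k F (i + 1) '' pagesUpTo a k i r ⊆
        levelsUpTo a (i + 1) (maxHeight a k F (i + 1) r) := by
      rintro _ ⟨x, hx, rfl⟩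
      obtain ⟨hx, hxr⟩ := mem_pagesUpTo.1 hx
      refine ⟨(h.fMap_succ_mem_levelsUpTo hf hx hr hxr).1, ?_⟩
      obtain ⟨z, hz, c, hocc, -, hxz, hc⟩ := h.fMap_succ_eq hf hx
      rw [hxz, Function.update_self]
      refine (Nat.count_monotone _ (Nat.succ_le_succ (hc r hr hxr))).trans ?_
      have := h.ncard_Stack hf hz r
      rw [Nat.succ_eq_add_one, ← this]
      exact le_csSup ⟨_, hub⟩ ⟨z, hz, rfl⟩
    have hinj : Set.InjOn (fMap a k F (i + 1)) (pagesUpTo a k i r) :=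
      (h.fillsPages_succ hf).injOn.mono fun x hx => (mem_pagesUpTo.1 hx).1
    have hfin : (levelsUpTo a (i + 1) (maxHeight a k F (i + 1) r)).Finite := by
      rw [levelsUpTo_eq_box (by omega)]
      exact box_finite _ _
    have hcard := Set.ncard_le_ncard hsub hfin
    rw [hinj.ncard_image, ncard_pagesUpTo (by omega) hr,
      ncard_levelsUpTo h.side_pos (by omega) h.lt, Nat.add_sub_cancel] at hcard
    exact stackLevels_le_iff.2 hcard

end Admissible

/-! ### The induction over dimensions and the stability of coordinates -/

theorem fMap_fillsPages {a : ℕ → ℕ} {k : ℕ} {F : ℕ → ℕ → ℕ → ℤ}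
    (hF : ∀ i, 2 ≤ i → i + 1 ≤ k → Admissible a k F i)
    (ha : ∀ i, 1 ≤ i → i ≤ k → 2 ^ 22 ≤ a i) {i : ℕ} (hi : 2 ≤ i) (hik : i ≤ k) :
    FillsPages a k i (fMap a k F i) := by
  induction i, hi using Nat.le_induction with
  | base => exact f₂_fillsPages hik ha
  | succ i hi ih => exact (hF i hi hik).fillsPages_succ (ih (by omega))

/-- Inflation and stacking alter only the coordinates `j` and `j + 1`. -/
theorem fMap_succ_apply_of_lt (a : ℕ → ℕ) (k : ℕ) (F : ℕ → ℕ → ℕ → ℤ) {j q : ℕ} (hj : 2 ≤ j)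
    (hq : q < j) (x : Pt) : fMap a k F (j + 1) x q = fMap a k F j x q := by
  rw [fMap_succ a k F hj, Function.comp_apply, Function.comp_apply, sigma, stackMap,
    Function.update_of_ne (by omega), Function.update_of_ne hq.ne, inflate,
    Function.update_of_ne hq.ne]

theorem fMap_apply_eq (a : ℕ → ℕ) (k : ℕ) (F : ℕ → ℕ → ℕ → ℤ) {i j q : ℕ} (hi : 1 ≤ i)
    (hij : i + 1 ≤ j) (hq : q ≤ i) (x : Pt) : fMap a k F j x q = fMap a k F (i + 1) x q := by
  induction j, hij using Nat.le_induction with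
  | base => rfl
  | succ j hj ih => rw [fMap_succ_apply_of_lt a k F (by omega) (by omega), ih]

/-! ### Containment in the optimal hypercube -/

theorem sum_expo_sub {a : ℕ → ℕ} {k i : ℕ} (ha : ∀ t, 1 ≤ t → t ≤ k → 1 ≤ a t) (hi : i ≤ k) :
    ∑ t ∈ Finset.Icc 1 i, (expo a t - expo a (t - 1)) = expo a i := by
  induction i with
  | zero => simp [expo_zero]
  | succ i ih =>
    have := expo_le_expo ha (show i ≤ i + 1 by omega) hi
    rw [Finset.sum_Icc_succ_top (by omega), ih (by omega), Nat.add_sub_cancel]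
    omega

theorem optDim_eq (a : ℕ → ℕ) (k : ℕ) : optDim a k = expo a k := by
  rw [optDim, ncard_grid, expo]

/-- The last side gets whatever exponent is missing, so the exponents of the sides add up to the
dimension of the cube. -/
theorem optGrid_isSpanningSubgraphOfCube {a : ℕ → ℕ} {k i : ℕ}
    (ha : ∀ t, 1 ≤ t → t ≤ k → 1 ≤ a t) (hi : 1 ≤ i) (hik : i ≤ k) :
    IsSpanningSubgraphOfCube (optGrid a k i) (optDim a k) := by
  obtain ⟨j, rfl⟩ : ∃ j, i = j + 1 := ⟨i - 1, by omega⟩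
  have h1 : expo a j ≤ expo a k := expo_le_expo ha (by omega) le_rfl
  have h := box_isSpanningSubgraphOfCube (Function.update (fun q => expo a q - expo a (q - 1))
    (j + 1) (optDim a k - expo a j)) (j + 1)
  have h2 : ∑ t ∈ Finset.Icc 1 (j + 1), Function.update (fun q => expo a q - expo a (q - 1))
      (j + 1) (optDim a k - expo a j) t = optDim a k := by
    rw [Finset.sum_Icc_succ_top (by omega), Function.update_self, Finset.sum_congr rfl
      (g := fun q => expo a q - expo a (q - 1)), sum_expo_sub ha (by omega), optDim_eq]
    · omega
    · intro q hq
      have := Finset.mem_Icc.1 hq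
      exact Function.update_of_ne (by omega) _ _
  have h3 : optGrid a k (j + 1) = box (j + 1) fun q => 2 ^ Function.update
      (fun q => expo a q - expo a (q - 1)) (j + 1) (optDim a k - expo a j) q := by
    rw [optGrid, levelsUpTo_eq_box (by omega), Nat.add_sub_cancel]
    congr 1
    funext q
    by_cases hq : q = j + 1
    · simp [hq]
    · simp [hq, width]
  rw [h2] at h
  rwa [h3]

theorem bracketY_isSpanningSubgraphOfCube {a : ℕ → ℕ} {k : ℕ}
    (ha : ∀ t, 1 ≤ t → t ≤ k → 1 ≤ a t) :
    IsSpanningSubgraphOfCube (bracketY a k) (optDim a k) := by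
  have h := box_isSpanningSubgraphOfCube (fun q => expo a q - expo a (q - 1)) k
  rwa [sum_expo_sub ha le_rfl, ← optDim_eq] at h

theorem flatMap_range'_mem_cube {g : ℕ → List Bool} {m : ℕ → ℕ} {k : ℕ}
    (h : ∀ j, 1 ≤ j → j ≤ k → g j ∈ cube (m j)) :
    (List.range' 1 k).flatMap g ∈ cube (∑ j ∈ Finset.Icc 1 k, m j) := by
  induction k with
  | zero => simp [cube]
  | succ k ih =>
    rw [List.range'_1_concat, List.flatMap_append, Finset.sum_Icc_succ_top (by omega)]
    refine append_mem_cube (ih fun j h1 h2 => h j h1 (by omega)) ?_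
    rw [add_comm 1 k]
    simpa using h (k + 1) (by omega) le_rfl

theorem numLevels_eq {a : ℕ → ℕ} {k i : ℕ} (hi : i ≤ k) :
    numLevels a k i = pageLevels a i (numPages a k i) := by
  rw [numLevels, pageLevels, ncard_grid, numPages_mul_vol hi]

theorem numLevels_le {a : ℕ → ℕ} {k i : ℕ} (ha : ∀ t, 1 ≤ t → t ≤ k → 1 ≤ a t) (hi : i ≤ k) :
    numLevels a k i ≤ 2 ^ (optDim a k - expo a (i - 1)) := by
  have h1 : expo a (i - 1) ≤ expo a k := expo_le_expo ha (by omega) le_rfl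
  rw [numLevels, ceil_div_two_pow_le, ← pow_add, optDim_eq, Nat.sub_add_cancel h1, ncard_grid]
  exact vol_le_two_pow_expo a k

/-- At the final stage the power of two bounding the number of levels is the last width. -/
theorem FillsPages.mem_bracketY {a : ℕ → ℕ} {k : ℕ} {f : Pt → Pt}
    (ha : ∀ t, 1 ≤ t → t ≤ k → 1 ≤ a t) (hk : 1 ≤ k) (hf : FillsPages a k k f) {x : Pt}
    (hx : x ∈ grid a k) : f x ∈ bracketY a k := by
  have h1 := hf.mem x hx _ (pageIndex_le_numPages hx le_rfl)
  have h2 := numLevels_le ha le_rfl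
  rw [← numLevels_eq le_rfl] at h1
  rw [optDim_eq] at h2
  refine ⟨fun q hq hq' => ?_, h1.1.2.2⟩
  rcases hq'.eq_or_lt with rfl | hq'
  · exact ⟨h1.1.2.1, h1.2.trans h2⟩
  · exact h1.1.1 q hq hq'

/-! ### Consequences of the invariant at one stage -/

namespace Admissible

variable {a : ℕ → ℕ} {k : ℕ} {F : ℕ → ℕ → ℕ → ℤ} {i : ℕ}

/-- The point of `⟨Y_i⟩` and the section that determine the `i`-th coordinates of `I_i(f_i(x))`
and `f_k(x)`. -/
theorem coordinate_eq (h : Admissible a k F i) (hf : FillsPages a k i (fMap a k F i)) {x : Pt}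
    (hx : x ∈ grid a k) : ∃ c, 1 ≤ c ∧ c ≤ numPages a k i ∧
      inflate a k F i (fMap a k F i x) i = (c - 1) * width a i + fMap a k F k x i ∧
      fMap a k F k x i ∈ Finset.Icc 1 (width a i) ∧ F i c (fMap a k F k x i) = 0 := by
  have hi := h.two_le
  obtain ⟨z, hz, c, hocc, hxc, hxz, -⟩ := h.fMap_succ_eq hf hx
  have h1 : fMap a k F k x i = z i := by
    rw [fMap_apply_eq a k F (by omega) h.lt le_rfl, hxz, Function.update_of_ne (by omega)]
  refine ⟨c, hocc.1, hocc.2.1, ?_, ?_, ?_⟩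
  · rw [hxc, cell_apply_self, h1]
  · rw [h1]
    exact Finset.mem_Icc.2 (hz.1 i (by omega) le_rfl)
  · rw [h1]
    exact h.entry_eq_zero_of_occupied hf hz hocc

/-- The coordinate of $f_k$ is the inflated level reduced modulo the width, so the density bound on
nonblank levels applies directly. -/
theorem coordinate_growth (h : Admissible a k F i) (hf : FillsPages a k i (fMap a k F i))
    {x y : Pt} (hx : x ∈ grid a k) (hy : y ∈ grid a k) {ε : ℕ}
    (hε : |(fMap a k F i x i : ℤ) - fMap a k F i y i| ≤ ε) :
    ∃ m : ℤ, |(fMap a k F k x i : ℤ) - fMap a k F k y i - m * width a i| ≤ 2 * ε + 2 := by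
  classical
  obtain ⟨c, hc, -, h1, -⟩ := h.coordinate_eq hf hx
  obtain ⟨d, hd, -, h2, -⟩ := h.coordinate_eq hf hy
  obtain ⟨h3, h4⟩ := h.inflate_apply_self (h.fMap_mem_levelsUpTo hf hx)
  obtain ⟨h5, h6⟩ := h.inflate_apply_self (h.fMap_mem_levelsUpTo hf hy)
  set m := inflate a k F i (fMap a k F i x) i
  set n := inflate a k F i (fMap a k F i y) i
  -- The multiple of the width is the difference of the section numbers.
  refine ⟨d - c, ?_⟩
  have e : (fMap a k F k x i : ℤ) - fMap a k F k y i - (d - c) * width a i = m - n := by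
    rw [h1, h2]
    push_cast [hc, hd]
    ring
  rw [e]
  have hε' := abs_le.1 hε
  rcases le_total m n with hmn | hmn
  · have := h.level_sub_le h3 h5 hmn
    rw [abs_le]
    constructor <;> omega
  · have := h.level_sub_le h5 h3 hmn
    rw [abs_le]
    constructor <;> omega

/-- Within one section a point is determined by its reduction. -/
theorem proj_sigma_injOn (h : Admissible a k F i) (hf : FillsPages a k i (fMap a k F i)) {r : ℕ}
    (hr : 1 ≤ r) : Set.InjOn (fun y => proj i (sigma a k F i y)) (secG' a k F i r) := by
  rintro y ⟨⟨hy1, -⟩, hy2⟩ y' ⟨⟨hy1', -⟩, hy2'⟩ heq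
  obtain ⟨x, hx, hyx, hocc⟩ := h.exists_eq_occupied_cell hf hy2
  obtain ⟨x', hx', hyx', hocc'⟩ := h.exists_eq_occupied_cell hf hy2'
  rw [section_eq_of_mem_sec hr hy1] at hyx hocc
  rw [section_eq_of_mem_sec hr hy1'] at hyx' hocc'
  simp only at heq
  rw [hyx, hyx', h.sigma_cell hf hx hocc.1 hocc.2.1, h.sigma_cell hf hx' hocc'.1 hocc'.2.1,
    proj_update_succ hx, proj_update_succ hx'] at heq
  rw [hyx, hyx', heq]

/-- Across sections the height takes over: the count strictly increases at each occupied section, so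
it recovers the section. -/
theorem sigma_injOn (h : Admissible a k F i) (hf : FillsPages a k i (fMap a k F i)) (r : ℕ) :
    Set.InjOn (sigma a k F i) (secsG' a k F i r) := by
  rintro y ⟨-, hy⟩ y' ⟨-, hy'⟩ heq
  obtain ⟨x, hx, hyx, hocc⟩ := h.exists_eq_occupied_cell hf hy
  obtain ⟨x', hx', hyx', hocc'⟩ := h.exists_eq_occupied_cell hf hy'
  generalize (y i - 1) / width a i + 1 = c at hyx hocc
  generalize (y' i - 1) / width a i + 1 = c' at hyx' hocc'
  rw [hyx, hyx', h.sigma_cell hf hx hocc.1 hocc.2.1, h.sigma_cell hf hx' hocc'.1 hocc'.2.1] at heq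
  obtain ⟨rfl, h1⟩ := eq_of_update_succ_eq hx hx' heq
  rw [hyx, hyx', count_occupied_injective hocc hocc' h1]

theorem secsG'_eq (h : Admissible a k F i) (hf : FillsPages a k i (fMap a k F i)) {r : ℕ}
    (hr : 1 ≤ r) (hr' : r < numPages a k i) : secsG' a k F i r = secsG a k F i r := by
  refine Set.inter_eq_left.2 fun y hy => ?_
  obtain ⟨x, hx, -, hxy⟩ := h.exists_inflate_fMap_eq hf hr hr' hy
  exact ⟨x, hx, hxy⟩

theorem secsG_ssubset (h : Admissible a k F i) (hf : FillsPages a k i (fMap a k F i)) {r : ℕ}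
    (hr : 1 ≤ r) (hr' : r + 1 ≤ numPages a k i) :
    secsG a k F i r ⊂ inflate a k F i '' (fMap a k F i '' pagesUpTo a k i (r + 1)) := by
  have hi := h.two_le
  refine ⟨fun y hy => ?_, fun hsub => ?_⟩
  · obtain ⟨x, hx, hxr, hxy⟩ := h.exists_inflate_fMap_eq hf hr hr' hy
    exact ⟨_, ⟨x, mem_pagesUpTo.2 ⟨hx, hxr⟩, rfl⟩, hxy⟩
  -- Any point in level `pageLevels a i r + 1` witnesses strictness: `r + 1` pages reach it, but it
  -- inflates beyond section `r`.
  · obtain ⟨y, hy⟩ := bracketY_nonempty a i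
    have h1 : Function.update y i (pageLevels a i r + 1) ∈
        levelsUpTo a i (pageLevels a i r + 1) := by
      refine ⟨⟨fun q hq hq' => ?_, ?_, fun q hq => ?_⟩, ?_⟩
      · rw [Function.update_of_ne hq'.ne]
        exact hy.1 q hq hq'.le
      · simp
      · rw [Function.update_of_ne (by omega)]
        exact hy.2 q hq
      · simp
    obtain ⟨x, hx, hxr, hxy⟩ := hf.exists_eq r hr hr' _ h1
    have h2 := mem_secsG.1 (hsub ⟨_, ⟨x, mem_pagesUpTo.2 ⟨hx, hxr⟩, rfl⟩, rfl⟩)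
    have h3 := (h.inflate_le_iff (h.fMap_mem_levelsUpTo hf hx) (show r ≤ _ by omega)).1 h2.2.2
    rw [hxy, Function.update_self] at h3
    omega

theorem stack_monotone (h : Admissible a k F i) (hf : FillsPages a k i (fMap a k F i)) {x y z : Pt}
    (hy : y ∈ inflatedImage a k F i) (hz : z ∈ inflatedImage a k F i)
    (hyx : proj i (sigma a k F i y) = x) (hzx : proj i (sigma a k F i z) = x) {c d : ℕ}
    (hc : 1 ≤ c) (hd : 1 ≤ d) (hyc : y ∈ sec a i c) (hzd : z ∈ sec a i d) :
    sigma a k F i y (i + 1) < sigma a k F i z (i + 1) ↔ c < d := by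
  classical
  obtain ⟨u, hu, hyu, hoc⟩ := h.exists_eq_occupied_cell hf hy
  obtain ⟨v, hv, hzv, hod⟩ := h.exists_eq_occupied_cell hf hz
  rw [section_eq_of_mem_sec hc hyc] at hyu hoc
  rw [section_eq_of_mem_sec hd hzd] at hzv hod
  rw [hyu, h.sigma_cell hf hu hoc.1 hoc.2.1] at hyx ⊢
  rw [hzv, h.sigma_cell hf hv hod.1 hod.2.1] at hzx ⊢
  rw [proj_update_succ hu] at hyx
  rw [proj_update_succ hv] at hzx
  subst hyx hzx
  rw [Function.update_self, Function.update_self]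
  constructor
  · intro hlt
    by_contra hle
    have := Nat.count_monotone (Occupied a k F i v) (show d + 1 ≤ c + 1 by omega)
    omega
  · intro hlt
    have := Nat.count_monotone (Occupied a k F i v) (show c + 1 ≤ d by omega)
    rw [Nat.count_succ _ d, if_pos hod]
    omega

end Admissible

end GridEmbedding

theorem lemma5p1 (k : ℕ) (hk : 2 ≤ k) (a : ℕ → ℕ)
    (ha : ∀ i, 1 ≤ i → i ≤ k → 2 ^ 22 ≤ a i)
    (F : ℕ → ℕ → ℕ → ℤ)
    (hF : ∀ i, 2 ≤ i → i + 1 ≤ k → IsBlankMatrix a k i (F i))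
    (L : ℕ → List Bool → ℕ)
    (hL : ∀ t, Set.BijOn (L t) (cube t) (Set.Icc 1 (2 ^ t))) :
    -- earlier coordinates are preserved
    (∀ x ∈ grid a k, ∀ i j, 1 ≤ i → i + 1 ≤ j → j ≤ k →
      proj i (fMap a k F j x) = proj i (fMap a k F (i + 1) x)) ∧
    -- the coordinate `i` of `f_k` in terms of the zeros of `F(i)`
    (∀ x ∈ grid a k, ∀ i, 2 ≤ i → i + 1 ≤ k →
      (∀ q, q ≠ i → inflate a k F i (fMap a k F i x) q = fMap a k F i x q) ∧
      ∃ r b, 1 ≤ r ∧ r ≤ numPages a k i ∧ 1 ≤ b ∧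
        b ≤ ((Finset.Icc 1 (width a i)).filter fun d => F i r d = 0).card ∧
        inflate a k F i (fMap a k F i x) i = (r - 1) * width a i + zeroCol F i r b ∧
        fMap a k F k x i = zeroCol F i r b ∧
        1 ≤ fMap a k F k x i ∧ fMap a k F k x i ≤ width a i) ∧
    -- coordinate growth, the difference being taken modulo `2 ^ (e_i - e_{i-1})`
    (∀ x ∈ grid a k, ∀ y ∈ grid a k, ∀ i ε : ℕ, 2 ≤ i → i ≤ k →
      |(fMap a k F i x i : ℤ) - fMap a k F i y i| ≤ ε →
      ∃ m : ℤ, |(fMap a k F k x i : ℤ) - fMap a k F k y i - m * width a i| ≤ 2 * ε + 2) ∧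
    -- injectivity of the projected stacking map on each section, of `σ_i`, and of `f_i`
    (∀ i, 2 ≤ i → i + 1 ≤ k →
      (∀ r, 1 ≤ r → r ≤ numPages a k i →
        Set.InjOn (fun y => proj i (sigma a k F i y)) (secG' a k F i r)) ∧
      Set.InjOn (sigma a k F i) (secsG' a k F i (numPages a k i))) ∧
    (∀ i, 2 ≤ i → i ≤ k → Set.InjOn (fMap a k F i) (grid a k)) ∧
    -- all sections but the last are filled
    (∀ i r, 2 ≤ i → i + 1 ≤ k → 1 ≤ r → r < numPages a k i →
      secsG' a k F i r = secsG a k F i r) ∧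
    -- balanced stack heights
    (∀ i t, 3 ≤ i → i ≤ k → 1 ≤ t → t < numPages a k (i - 1) →
      (∀ x ∈ bracketY a (i - 1),
        (Stack a k F i x t).ncard = maxHeight a k F i t ∨
        (Stack a k F i x t).ncard + 1 = maxHeight a k F i t) ∧
      ∀ x ∈ bracketY a (i - 1), ∀ y ∈ bracketY a (i - 1), x (i - 1) = y (i - 1) →
        (Stack a k F i x t).ncard = (Stack a k F i y t).ncard) ∧
    -- the maximum stack height
    (∀ i r, 3 ≤ i → i ≤ k → 1 ≤ r → r ≤ numPages a k (i - 1) →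
      maxHeight a k F i r
        = ⌈((pagesUpTo a k (i - 1) r).ncard : ℚ) / 2 ^ expo a (i - 1)⌉₊ ∧
      maxHeight a k F i r = ⌈((r * vol a (i - 1) : ℕ) : ℚ) / 2 ^ expo a (i - 1)⌉₊ ∧
      ((levelsUpTo a i ⌈((pagesUpTo a k (i - 1) r).ncard : ℚ) / 2 ^ expo a (i - 1)⌉₊).ncard : ℤ)
        - ((fMap a k F i '' pagesUpTo a k (i - 1) r).ncard : ℤ) < 2 ^ expo a (i - 1)) ∧
    -- images of unions of pages
    (∀ i r, 3 ≤ i → i ≤ k → 1 ≤ r → r ≤ numPages a k (i - 1) →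
      fMap a k F i '' pagesUpTo a k (i - 1) r ⊆
        levelsUpTo a i ⌈((pagesUpTo a k (i - 1) r).ncard : ℚ) / 2 ^ expo a (i - 1)⌉₊) ∧
    (∀ i r, 3 ≤ i → i ≤ k → 1 ≤ r → r ≤ numPages a k i →
      (pagesUpTo a k i r).ncard = r * vol a i ∧
      fMap a k F i '' pagesUpTo a k i r ⊆
        levelsUpTo a i ⌈((pagesUpTo a k i r).ncard : ℚ) / 2 ^ expo a (i - 1)⌉₊) ∧
    -- containment in the optimal hypercube
    (∀ i, 2 ≤ i → i ≤ k →
      fMap a k F i '' grid a k ⊆ levelsUpTo a i (numLevels a k i) ∧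
      levelsUpTo a i (numLevels a k i) ⊆ optGrid a k i ∧
      IsSpanningSubgraphOfCube (optGrid a k i) (optDim a k)) ∧
    fMap a k F k '' grid a k ⊆ bracketY a k ∧
    IsSpanningSubgraphOfCube (bracketY a k) (optDim a k) ∧
    cubeMap a k F L '' grid a k ⊆ cube (optDim a k) ∧
    -- inflation containments
    (∀ i r, 2 ≤ i → i + 1 ≤ k → 1 ≤ r → r ≤ numPages a k i →
      inflate a k F i '' (fMap a k F i '' pagesUpTo a k i r) ⊆ secsG a k F i r) ∧
    (∀ i r, 2 ≤ i → i + 1 ≤ k → 1 ≤ r → r + 1 ≤ numPages a k i →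
      secsG a k F i r ⊂ inflate a k F i '' (fMap a k F i '' pagesUpTo a k i (r + 1))) ∧
    -- stack monotonicity
    (∀ i r, 3 ≤ i → i ≤ k → 1 ≤ r → r ≤ numPages a k (i - 1) → ∀ x ∈ bracketY a (i - 1),
      ∀ y' ∈ secsG' a k F (i - 1) (numPages a k (i - 1)),
      ∀ y'' ∈ secsG' a k F (i - 1) (numPages a k (i - 1)),
      sigma a k F (i - 1) y' ∈ Stack a k F i x r → sigma a k F (i - 1) y'' ∈ Stack a k F i x r →
      ∀ c d, 1 ≤ c → c ≤ r → 1 ≤ d → d ≤ r →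
      y' ∈ sec a (i - 1) c → y'' ∈ sec a (i - 1) d →
      (sigma a k F (i - 1) y' i < sigma a k F (i - 1) y'' i ↔ c < d)) := by
  have ha1 : ∀ t, 1 ≤ t → t ≤ k → 1 ≤ a t := fun t h1 h2 =>
    (by norm_num : 1 ≤ 2 ^ 22).trans (ha t h1 h2)
  have hA : ∀ i, 2 ≤ i → i + 1 ≤ k → Admissible a k F i := fun i h1 h2 => ⟨h1, h2, ha, hF i h1 h2⟩
  have hf : ∀ i, 2 ≤ i → i ≤ k → FillsPages a k i (fMap a k F i) :=
    fun i h1 h2 => fMap_fillsPages hA ha h1 h2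
  refine ⟨?_, ?_, ?_, ?_, ?_, ?_, ?_, ?_, ?_, ?_, ?_, ?_, ?_, ?_, ?_, ?_, ?_⟩
  · intro x _ i j hi hij _
    funext q
    unfold proj
    split_ifs with hq
    · exact fMap_apply_eq a k F hi hij hq.2 x
    · rfl
  · intro x hx i hi hik
    refine ⟨fun q hq => Function.update_of_ne hq _ _, ?_⟩
    obtain ⟨c, hc, hc', h1, h2, h3⟩ := (hA i hi hik).coordinate_eq (hf i hi (by omega)) hx
    have h4 := (hA i hi hik).zeroCol_card (Finset.mem_Icc.2 ⟨hc, hc'⟩) h2 h3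
    have h2' := Finset.mem_Icc.1 h2
    refine ⟨c, _, hc, hc', ?_, ?_, h1.trans (by rw [h4]), h4.symm, h2'.1, h2'.2⟩
    · exact Finset.card_pos.2 ⟨_, Finset.mem_filter.2 ⟨Finset.mem_Icc.2 ⟨h2'.1, le_rfl⟩, h3⟩⟩
    · exact Finset.card_le_card
        (Finset.filter_subset_filter _ (Finset.Icc_subset_Icc_right h2'.2))
  · intro x hx y hy i ε hi hik hε
    rcases hik.eq_or_lt with rfl | hik
    -- For `i = k` nothing is inflated, so no wrapping occurs and the difference is at most `ε`.
    · refine ⟨0, ?_⟩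
      rw [zero_mul, sub_zero]
      omega
    · exact (hA i hi hik).coordinate_growth (hf i hi hik.le) hx hy hε
  · intro i hi hik
    have h := hA i hi hik
    have hfi := hf i hi (by omega)
    exact ⟨fun r hr _ => h.proj_sigma_injOn hfi hr, h.sigma_injOn hfi _⟩
  · exact fun i hi hik => (hf i hi hik).injOn
  · exact fun i r hi hik hr hr' => (hA i hi hik).secsG'_eq (hf i hi (by omega)) hr hr'
  · intro i t hi hik ht ht'
    obtain ⟨j, rfl⟩ : ∃ j, i = j + 1 := ⟨i - 1, by omega⟩
    rw [Nat.add_sub_cancel] at *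
    have h := hA j (by omega) hik
    have hfj := hf j (by omega) (by omega)
    refine ⟨fun x hx => ?_, fun x hx y hy hxy => ?_⟩
    · have h1 := h.count_occupied_le_stackLevels hfj hx ht'.le
      have h2 := h.stackLevels_le_count_occupied hfj hx ht'
      rw [h.ncard_Stack hfj hx, h.maxHeight_eq hfj ht'.le]
      omega
    · have h1 := h.count_occupied_eq hfj hx ht'
      have h2 := h.count_occupied_eq hfj hy ht'
      rw [h.ncard_Stack hfj hx, h.ncard_Stack hfj hy]
      rw [hxy] at h1
      omega
  · intro i r hi hik hr hr'
    obtain ⟨j, rfl⟩ : ∃ j, i = j + 1 := ⟨i - 1, by omega⟩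
    rw [Nat.add_sub_cancel] at *
    have h := hA j (by omega) hik
    have hfj := hf j (by omega) (by omega)
    have hinj : Set.InjOn (fMap a k F (j + 1)) (pagesUpTo a k j r) :=
      (hf (j + 1) (by omega) hik).injOn.mono fun x hx => (mem_pagesUpTo.1 hx).1
    rw [hinj.ncard_image, ncard_levelsUpTo ha1 (by omega) hik, Nat.add_sub_cancel,
      ncard_pagesUpTo (by omega) hr']
    refine ⟨h.maxHeight_eq hfj hr', h.maxHeight_eq hfj hr', ?_⟩
    have := ceil_mul_two_pow_lt (r * vol a j) (expo a j)
    rw [sub_lt_iff_lt_add']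
    exact_mod_cast this
  · rintro i r hi hik hr hr' _ ⟨x, hx, rfl⟩
    obtain ⟨j, rfl⟩ : ∃ j, i = j + 1 := ⟨i - 1, by omega⟩
    rw [Nat.add_sub_cancel] at *
    obtain ⟨hx, hxr⟩ := mem_pagesUpTo.1 hx
    rw [ncard_pagesUpTo (by omega) hr']
    exact (hA j (by omega) hik).fMap_succ_mem_levelsUpTo (hf j (by omega) (by omega)) hx hr' hxr
  · intro i r hi hik hr hr'
    refine ⟨ncard_pagesUpTo hik hr', ?_⟩
    rintro _ ⟨x, hx, rfl⟩
    obtain ⟨hx, hxr⟩ := mem_pagesUpTo.1 hx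
    rw [ncard_pagesUpTo hik hr']
    exact (hf i (by omega) hik).mem x hx r hxr
  · intro i hi hik
    refine ⟨?_, fun x hx => ⟨hx.1, hx.2.trans (numLevels_le ha1 hik)⟩,
      optGrid_isSpanningSubgraphOfCube ha1 (by omega) hik⟩
    rintro _ ⟨x, hx, rfl⟩
    rw [numLevels_eq hik]
    exact (hf i hi hik).mem x hx _ (pageIndex_le_numPages hx hik)
  · rintro _ ⟨x, hx, rfl⟩
    exact (hf k hk le_rfl).mem_bracketY ha1 (by omega) hx
  · exact bracketY_isSpanningSubgraphOfCube ha1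
  · rintro _ ⟨x, hx, rfl⟩
    have h1 := (hf k hk le_rfl).mem_bracketY ha1 (by omega) hx
    rw [optDim_eq, ← sum_expo_sub ha1 le_rfl]
    refine flatMap_range'_mem_cube fun j hj hjk => ?_
    -- Each coordinate lies in `1, …, width a j`, the range of the labelling, so the chosen preimage
    -- is a genuine string of the required length.
    exact Function.invFunOn_mem ((hL _).surjOn (h1.1 j hj hjk))
  · rintro i r hi hik hr hr' _ ⟨_, ⟨x, hx, rfl⟩, rfl⟩
    obtain ⟨hx, hxr⟩ := mem_pagesUpTo.1 hx
    exact (hA i hi hik).inflate_fMap_mem (hf i hi (by omega)) hx hr' hxr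
  · exact fun i r hi hik hr hr' => (hA i hi hik).secsG_ssubset (hf i hi (by omega)) hr hr'
  · rintro i r hi hik hr hr' x - y hy z hz ⟨_, -, -, hyx⟩ ⟨_, -, -, hzx⟩ c d hc - hd - hyc hzd
    obtain ⟨j, rfl⟩ : ∃ j, i = j + 1 := ⟨i - 1, by omega⟩
    rw [Nat.add_sub_cancel] at *
    exact (hA j (by omega) hik).stack_monotone (hf j (by omega) (by omega)) hy.2 hz.2 hyx hzx hc hd
      hyc hzd
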